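/- Let $\Omega\subset\mathbb{R}^d$ be a compact convex set with non-empty interior $\Omega^\circ$. Let $X_0,X_1$ be independent random vectors with Lebesgue densities $p_0,p_1$ that vanish outside $\Omega$ and whose restrictions to $\Omega$ are continuous and bounded away from zero. For $t\in[0,1]$ define $$v(t,z)=\frac{\int_{\mathbb{R}^d}\delta\,p_0(z-t\delta)\,p_1(z+(1-t)\delta)\,d\delta}{\int_{\mathbb{R}^d}p_0(z-t\delta)\,p_1(z+(1-t)\delta)\,d\delta}$$ (with the value $0$ where the denominator vanishes; this can only happen for $z\notin\Omega^\circ$), and, for $\eta\ge 0$, $$\omega(\eta)=\sup_{z,z'\in\Omega,\ \|z-z'\|\le\eta}\max\left\{\left|\frac{p_0(z)}{p_0(z')}-1\right|,\ \left|\frac{p_1(z)}{p_1(z')}-1\right|\right\}.$$ Assume that $\eta\mapsto\omega(\eta)+\eta$ is a non-decreasing Osgood function, that is, $\int_\varepsilon^1\frac{du}{u+\omega(u)}\to\infty$ as $\varepsilon\downarrow0$. Then for every $t\in[0,1]$ the function $v(t,\cdot)$ is continuous on $\Omega^\circ$ and $v(t,(1-t)X_0+tX_1)=\mathbb{E}[X_1-X_0\mid(1-t)X_0+tX_1]$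 almost surely. Moreover, for every $x\in\Omega^\circ$ there is exactly one function $z:[0,1]\to\mathbb{R}^d$ such that $s\mapsto v(s,z(s))$ is integrable on $[0,1]$ and $$z(t)=x+\int_0^t v(s,z(s))\,ds\qquad\text{for all }t\in[0,1]$$ (a Carathéodory solution of $z'(t)=v(t,z(t))$, $z(0)=x$). This solution satisfies $z(t)\in\Omega^\circ$ for all $t\in[0,1)$ and $z(1)\in\Omega$. -/

import Mathlib

open MeasureTheory ProbabilityTheory Set Filter Topology

noncomputable section

namespace RectifiedFlow

/-- `p` is a function that is continuous and bounded away from zero on `Ω`,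
and vanishes off `Ω`. -/
structure IsRegularDensityOn {d : ℕ} (Ω : Set (EuclideanSpace ℝ (Fin d)))
    (p : EuclideanSpace ℝ (Fin d) → ℝ) : Prop where
  continuousOn : ContinuousOn p Ω
  bounded_away : ∃ c : ℝ, 0 < c ∧ ∀ x ∈ Ω, c ≤ p x
  eq_zero_off : ∀ x, x ∉ Ω → p x = 0

/-- `p_t(z) = ∫ p₀(z - tδ) p₁(z + (1-t)δ) dδ`. -/
def interpDensity {d : ℕ} (p₀ p₁ : EuclideanSpace ℝ (Fin d) → ℝ)
    (t : ℝ) (z : EuclideanSpace ℝ (Fin d)) : ℝ :=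
  ∫ δ, p₀ (z - t • δ) * p₁ (z + (1 - t) • δ)

/-- `f_t(z) = ∫ δ p₀(z - tδ) p₁(z + (1-t)δ) dδ`. -/
def interpFlux {d : ℕ} (p₀ p₁ : EuclideanSpace ℝ (Fin d) → ℝ)
    (t : ℝ) (z : EuclideanSpace ℝ (Fin d)) : EuclideanSpace ℝ (Fin d) :=
  ∫ δ, (p₀ (z - t • δ) * p₁ (z + (1 - t) • δ)) • δ

/-- The velocity field `v(t, z) = f_t(z) / p_t(z)` of the independent coupling: the pointwise
formula for `E[X₁ - X₀ | (1-t) X₀ + t X₁ = z]`. -/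
def velocity {d : ℕ} (p₀ p₁ : EuclideanSpace ℝ (Fin d) → ℝ)
    (t : ℝ) (z : EuclideanSpace ℝ (Fin d)) : EuclideanSpace ℝ (Fin d) :=
  (interpDensity p₀ p₁ t z)⁻¹ • interpFlux p₀ p₁ t z

/-- The joint relative modulus of continuity `ω(η)` of `p₀` and `p₁` on `Ω`. -/
def densityModulus {d : ℕ} (Ω : Set (EuclideanSpace ℝ (Fin d)))
    (p₀ p₁ : EuclideanSpace ℝ (Fin d) → ℝ) (η : ℝ) : ℝ :=
  sSup {r : ℝ | ∃ z ∈ Ω, ∃ z' ∈ Ω, ‖z - z'‖ ≤ η ∧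
    r = max |p₀ z / p₀ z' - 1| |p₁ z / p₁ z' - 1|}

/-- `κ` is a non-decreasing Osgood function: `κ(0) = 0`, and the primitive
`Ψ(ε) = ∫_1^ε du / κ(u)` tends to `-∞` as `ε ↓ 0`. -/
structure IsOsgood (κ : ℝ → ℝ) : Prop where
  monotoneOn : MonotoneOn κ (Ici 0)
  map_zero : κ 0 = 0
  tendsto_primitive : Tendsto (fun ε : ℝ => ∫ u in (1 : ℝ)..ε, 1 / κ u) (𝓝[>] 0) atBot

/-- `z` (read on `[0, 1]`) is a Carathéodory solution of `z' = v(t, z)`, `z(0) = x`: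
`s ↦ v(s, z(s))` is integrable and `z(t) = x + ∫_0^t v(s, z(s)) ds` for all `t ∈ [0, 1]`. -/
structure IsCaratheodorySolution {d : ℕ}
    (v : ℝ → EuclideanSpace ℝ (Fin d) → EuclideanSpace ℝ (Fin d))
    (x : EuclideanSpace ℝ (Fin d)) (z : ℝ → EuclideanSpace ℝ (Fin d)) : Prop where
  intervalIntegrable : IntervalIntegrable (fun s => v s (z s)) volume 0 1
  integral_eq : ∀ t ∈ Icc (0 : ℝ) 1, z t = x + ∫ s in (0 : ℝ)..t, v s (z s)

end RectifiedFlow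

end

namespace RectifiedFlow

/-! The kernel `p₀(z - tδ) p₁(z + (1-t)δ)` is the joint density of the interpolant and the
displacement, because passing from (interpolant, displacement) to the two endpoints is a composition
of shears and preserves volume. So `velocity` is the mean displacement given the interpolant
(`velocity_ae_eq_condExp`). It is bounded by the diameter of `Ω`, and it is jointly continuous on
`[0, 1] × interior Ω`, since the kernel jumps only at the boundary of `Ω`, a null set by convexity.

Existence: a Peano argument yields a curve that solves the equation until it leaves the interior
(`exists_solution_until_exit`). It cannot leave before time `1`. If `l ≤ b` on `Ω`, then `z + (1-t)
v(t, z)`, a mean of points of `Ω`, also satisfies `l ≤ b`. Hence `(b - l(z(t))) / (1-t)` is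
non-decreasing along the curve, and over all half-spaces this says `z(τ) ∈ (1-τ)x + τΩ`, which is
interior for `τ < 1` (`mem_interior_of_solution`).

Uniqueness: near an interior point, moving `z` by `η` changes the values of the kernel by `O(ω(η))`
and, by convexity, its support by volume `O(η)`. The density is bounded below there, so `v` has
modulus `C(ω(η) + η)` (`exists_velocity_modulus`), and Osgood's lemma keeps two solutions together.
-/

/-! ### Osgood's lemma. -/

theorem intervalIntegrable_comp_of_monotoneOn {κ : ℝ → ℝ} (hκ : MonotoneOn κ (Ici 0))
    {a b : ℝ} (hab : a ≤ b) {w : ℝ → ℝ} (hw : ContinuousOn w (Icc a b))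
    (hw0 : ∀ t ∈ Icc a b, 0 ≤ w t) :
    IntervalIntegrable (fun s => κ (w s)) volume a b := by
  obtain ⟨m, hm⟩ := (isCompact_Icc.image_of_continuousOn hw).bddAbove
  -- `κ` may be discontinuous, so measurability comes from monotonicity; freezing `κ` to the left of
  -- `0` makes it monotone on the whole line.
  have hmono : Monotone (fun u => κ (max u 0)) := fun u v huv =>
    hκ (mem_Ici.2 (le_max_right _ _)) (mem_Ici.2 (le_max_right _ _)) (max_le_max_right 0 huv)
  have hmeas : AEMeasurable (fun s => κ (max (w s) 0)) (volume.restrict (Icc a b)) :=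
    hmono.measurable.comp_aemeasurable (hw.aemeasurable measurableSet_Icc)
  have heq : (fun s => κ (max (w s) 0)) =ᵐ[volume.restrict (Icc a b)] fun s => κ (w s) := by
    filter_upwards [ae_restrict_mem measurableSet_Icc] with s hs
    rw [max_eq_left (hw0 s hs)]
  rw [intervalIntegrable_iff_integrableOn_Icc_of_le hab]
  refine (integrable_const (max |κ 0| |κ m|)).mono' (hmeas.congr heq).aestronglyMeasurable ?_
  filter_upwards [ae_restrict_mem measurableSet_Icc] with s hs
  have h1 : w s ≤ m := hm (mem_image_of_mem w hs)
  have h2 : κ (w s) ≤ κ m := hκ (hw0 s hs) ((hw0 s hs).trans h1) h1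
  have h3 : κ 0 ≤ κ (w s) := hκ self_mem_Ici (hw0 s hs) (hw0 s hs)
  exact abs_le_max_abs_abs h3 h2

/-- Osgood's uniqueness lemma. -/
theorem IsOsgood.eq_zero_of_le_integral {κ : ℝ → ℝ} (hκ : IsOsgood κ)
    (hpos : ∀ u, 0 < u → 0 < κ u) {a b C : ℝ} (hC : 0 ≤ C) {w : ℝ → ℝ}
    (hw : ContinuousOn w (Icc a b)) (hw0 : ∀ t ∈ Icc a b, 0 ≤ w t)
    (hle : ∀ t ∈ Icc a b, w t ≤ ∫ s in a..t, C * κ (w s)) :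
    ∀ t ∈ Icc a b, w t = 0 := by
  intro t₁ ht₁
  have hab : a ≤ b := ht₁.1.trans ht₁.2
  have hκ0 : ∀ u, 0 ≤ u → 0 ≤ κ u := fun u hu => by
    have := hκ.monotoneOn self_mem_Ici hu hu
    rwa [hκ.map_zero] at this
  have hint : IntervalIntegrable (fun s => C * κ (w s)) volume a b :=
    (intervalIntegrable_comp_of_monotoneOn hκ.monotoneOn hab hw hw0).const_mul C
  have hsub : ∀ s ∈ Icc a b, ∀ t ∈ Icc a b,
      IntervalIntegrable (fun s => C * κ (w s)) volume s t := fun s hs t ht =>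
    hint.mono_set (by rw [uIcc_of_le hab]; exact ordConnected_Icc.uIcc_subset hs ht)
  set W : ℝ → ℝ := fun t => ∫ s in a..t, C * κ (w s) with hW
  have ha : a ∈ Icc a b := left_mem_Icc.2 hab
  have hb : b ∈ Icc a b := right_mem_Icc.2 hab
  have hdiff : ∀ s ∈ Icc a b, ∀ t ∈ Icc a b, W t - W s = ∫ s in s..t, C * κ (w s) :=
    fun s hs t ht =>
      intervalIntegral.integral_interval_sub_left (hsub a ha t ht) (hsub a ha s hs)
  have hmono : ∀ s ∈ Icc a b, ∀ t ∈ Icc a b, s ≤ t → W s ≤ W t := fun s hs t ht hst => by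
    rw [← sub_nonneg, hdiff s hs t ht]
    exact intervalIntegral.integral_nonneg hst fun u hu =>
      mul_nonneg hC (hκ0 _ (hw0 u ⟨hs.1.trans hu.1, hu.2.trans ht.2⟩))
  have hWc : ContinuousOn W (Icc a b) := by
    have := intervalIntegral.continuousOn_primitive_interval (a := a) (b := b)
      (f := fun s => C * κ (w s)) (μ := volume) (by
        rw [uIcc_of_le hab]
        exact (intervalIntegrable_iff_integrableOn_Icc_of_le hab).1 hint)
    rwa [uIcc_of_le hab] at this
  have hWa : W a = 0 := by simp [hW]
  by_contra hne
  have hc : 0 < W b :=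
    (lt_of_le_of_ne (hw0 t₁ ht₁) (Ne.symm hne)).trans_le
      ((hle t₁ ht₁).trans (hmono t₁ ht₁ b hb ht₁.2))
  set c := W b with hcdef
  have hκi : ∀ u v, 0 < u → 0 < v → IntervalIntegrable (fun u => 1 / κ u) volume u v := by
    intro u v hu hv
    apply AntitoneOn.intervalIntegrable
    intro x hx y hy hxy
    have hx0 : 0 < x := (lt_min hu hv).trans_le hx.1
    exact one_div_le_one_div_of_le (hpos x hx0)
      (hκ.monotoneOn hx0.le (hx0.le.trans hxy) hxy)
  -- Dyadic levels replace the differentiation of `Ψ(W(t))`. While `W` climbs from `c/2^(N+1)` to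
  -- `c/2^N`, its slope is at most `C κ(c/2^N)`, which bounds the elapsed time from below. The
  -- integral runs over levels twice as high, where `1/κ ≤ 1/κ(c/2^N)`. Summing, `∫ 1/κ` stays below
  -- `2C(b - a)`, against its divergence at `0`.
  have key : ∀ N : ℕ, ∃ t ∈ Icc a b, W t = c / 2 ^ N ∧
      ∫ u in (2 * (c / 2 ^ N))..(2 * c), 1 / κ u ≤ 2 * C * (b - t) := by
    intro N
    induction N with
    | zero => exact ⟨b, hb, by simp [hcdef], by simp⟩
    | succ N ih =>
      obtain ⟨t, ht, hWt, hI⟩ := ih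
      have hcN : 0 < c / 2 ^ N := by positivity
      have hhalf : c / 2 ^ (N + 1) = c / 2 ^ N / 2 := by rw [pow_succ]; field_simp
      obtain ⟨t', ht', hWt'⟩ : c / 2 ^ (N + 1) ∈ W '' Icc a t :=
        intermediate_value_Icc ht.1 (hWc.mono (Icc_subset_Icc_right ht.2))
          ⟨by rw [hWa]; positivity, by rw [hWt, hhalf]; linarith⟩
      have ht'b : t' ∈ Icc a b := ⟨ht'.1, ht'.2.trans ht.2⟩
      refine ⟨t', ht'b, hWt', ?_⟩
      have h1 : W t - W t' ≤ C * κ (c / 2 ^ N) * (t - t') := by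
        rw [hdiff t' ht'b t ht]
        have := intervalIntegral.integral_mono_on ht'.2 (hsub t' ht'b t ht)
          (intervalIntegrable_const (c := C * κ (c / 2 ^ N))) (fun u hu => by
            have hub : u ∈ Icc a b := ⟨ht'.1.trans hu.1, hu.2.trans ht.2⟩
            refine mul_le_mul_of_nonneg_left
              (hκ.monotoneOn (hw0 u hub) hcN.le ?_) hC
            rw [← hWt]
            exact (hle u hub).trans (hmono u hub t ht hu.2))
        rw [intervalIntegral.integral_const, smul_eq_mul, mul_comm] at this
        exact this
      rw [hWt, hWt', hhalf] at h1
      have h2 : ∫ u in (c / 2 ^ N)..(2 * (c / 2 ^ N)), 1 / κ u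
          ≤ c / 2 ^ N / κ (c / 2 ^ N) := by
        have := intervalIntegral.integral_mono_on (by linarith)
          (hκi (c / 2 ^ N) (2 * (c / 2 ^ N)) hcN (by linarith))
          (intervalIntegrable_const (c := 1 / κ (c / 2 ^ N))) (fun u hu =>
            one_div_le_one_div_of_le (hpos _ hcN)
              (hκ.monotoneOn hcN.le (hcN.le.trans hu.1) hu.1))
        refine this.trans (le_of_eq ?_)
        rw [intervalIntegral.integral_const, smul_eq_mul]
        ring
      have h3 : c / 2 ^ N / κ (c / 2 ^ N) ≤ 2 * C * (t - t') := by
        rw [div_le_iff₀ (hpos _ hcN)]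
        linarith
      have h4 : 2 * (c / 2 ^ (N + 1)) = c / 2 ^ N := by rw [hhalf]; ring
      rw [h4, ← intervalIntegral.integral_add_adjacent_intervals
        (hκi _ _ hcN (by positivity : 0 < 2 * (c / 2 ^ N)))
        (hκi _ _ (by positivity) (by positivity))]
      linarith
  have hlim : Tendsto (fun N : ℕ => 2 * (c / 2 ^ N)) atTop (𝓝[>] 0) := by
    refine tendsto_nhdsWithin_iff.2 ⟨?_, Eventually.of_forall fun N => by
      simp only [mem_Ioi]; positivity⟩
    have h := (tendsto_pow_atTop_nhds_zero_of_lt_one (r := (1 / 2 : ℝ))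
      (by norm_num) (by norm_num)).const_mul (2 * c)
    simp only [mul_zero] at h
    refine h.congr fun N => ?_
    rw [one_div, inv_pow]; ring
  obtain ⟨N, hN⟩ := ((hκ.tendsto_primitive.comp hlim).eventually_lt_atBot
    ((∫ u in (1 : ℝ)..(2 * c), 1 / κ u) - 2 * C * (b - a))).exists
  obtain ⟨t, ht, -, hI⟩ := key N
  have hadd := intervalIntegral.integral_add_adjacent_intervals
    (hκi 1 (2 * (c / 2 ^ N)) one_pos (by positivity))
    (hκi (2 * (c / 2 ^ N)) (2 * c) (by positivity) (by positivity))
  simp only [Function.comp_apply] at hN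
  have : 2 * C * (b - t) ≤ 2 * C * (b - a) :=
    mul_le_mul_of_nonneg_left (by linarith [ht.1]) (by positivity)
  linarith

/-! ### Existence for bounded measurable fields. -/

theorem intervalIntegrable_of_measurable_of_bounded {E : Type*}
    [NormedAddCommGroup E] [MeasurableSpace E] [BorelSpace E]
    [SecondCountableTopology E] {f : ℝ → E} {D : ℝ}
    (hf : Measurable f) (hD : ∀ s, ‖f s‖ ≤ D) (s t : ℝ) : IntervalIntegrable f volume s t :=
  (intervalIntegrable_const (c := D)).mono_fun hf.aestronglyMeasurable
    (Eventually.of_forall fun u => (hD u).trans (le_abs_self D))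

section Peano

variable {E : Type*} [NormedAddCommGroup E] [NormedSpace ℝ E]

theorem norm_integral_sub_integral_le [CompleteSpace E] {f : ℝ → E} {D : ℝ}
    (hf : ∀ s t, IntervalIntegrable f volume s t) (hD : ∀ s, ‖f s‖ ≤ D) (s t : ℝ) :
    ‖(∫ u in (0 : ℝ)..t, f u) - ∫ u in (0 : ℝ)..s, f u‖ ≤ D * |t - s| := by
  rw [intervalIntegral.integral_interval_sub_left (hf 0 t) (hf 0 s)]
  exact intervalIntegral.norm_integral_le_of_norm_le_const fun u _ => hD u

/-- Tonelli's delayed approximations. -/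
theorem exists_delayed_solution [FiniteDimensional ℝ E] [MeasurableSpace E] [BorelSpace E]
    {F : ℝ → E → E} (hF : Measurable (Function.uncurry F)) {D : ℝ}
    (hD : ∀ t x, ‖F t x‖ ≤ D) (x : E) (n : ℕ) :
    ∃ y : ℝ → E, (∀ s t, ‖y t - y s‖ ≤ D * |t - s|) ∧ y 0 = x ∧
      ∀ t ∈ Icc (0 : ℝ) 1, y t = x + ∫ s in (0 : ℝ)..t, F s (y (s - 1 / (n + 1))) := by
  have : ProperSpace E := FiniteDimensional.proper ℝ E
  have hD0 : 0 ≤ D := (norm_nonneg _).trans (hD 0 0)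
  set h : ℝ := 1 / (n + 1) with hh
  -- The truncation `max t 0` keeps every iterate equal to `x` at negative times, where the delayed
  -- argument needs a value.
  let Φ : (ℝ → E) → ℝ → E := fun y t => x + ∫ s in (0 : ℝ)..(max t 0), F s (y (s - h))
  obtain ⟨y, hzero, hsucc⟩ : ∃ y : ℕ → ℝ → E, (y 0 = fun _ => x) ∧ ∀ k, y (k + 1) = Φ (y k) :=
    ⟨fun k => Nat.rec (fun _ => x) (fun _ z => Φ z) k, rfl, fun _ => rfl⟩
  have hlip : ∀ k s t, ‖y k t - y k s‖ ≤ D * |t - s| := by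
    intro k
    induction k with
    | zero => intro s t; simp only [hzero, sub_self, norm_zero]; positivity
    | succ k ih =>
      intro s t
      have hcont : Continuous (y k) := by
        have : LipschitzWith ⟨D, hD0⟩ (y k) := LipschitzWith.of_dist_le_mul fun s t => by
          rw [dist_eq_norm, Real.dist_eq]; exact ih t s
        exact this.continuous
      have hm : Measurable fun s => F s (y k (s - h)) :=
        hF.comp (measurable_id.prodMk (hcont.measurable.comp (measurable_id.sub_const h)))
      rw [hsucc]
      simp only [Φ, add_sub_add_left_eq_sub]
      refine (norm_integral_sub_integral_le
        (intervalIntegrable_of_measurable_of_bounded hm fun s => hD _ _)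
        (fun s => hD _ _) _ _).trans (mul_le_mul_of_nonneg_left ?_ hD0)
      exact abs_max_sub_max_le_abs t s 0
  -- The value of `Φ y` at `t` depends on `y` only up to `t - h`, so each iteration settles one more
  -- interval of length `h`; after `n + 1` of them `[0, 1]` is covered.
  have hstab : ∀ k : ℕ, ∀ t : ℝ, t ≤ k * h → y (k + 1) t = y k t := by
    intro k
    induction k with
    | zero =>
      intro t ht
      have : max t 0 = 0 := max_eq_right (by simpa using ht)
      simp [hsucc, Φ, this, hzero]
    | succ k ih =>
      intro t ht
      rw [hsucc (k + 1), hsucc k]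
      simp only [Φ]
      congr 1
      refine intervalIntegral.integral_congr_ae (Eventually.of_forall fun s hs => ?_)
      rw [uIoc_of_le (le_max_right _ _)] at hs
      have : s - h ≤ k * h := by
        have h1 : s ≤ t := by
          rcases le_max_iff.1 hs.2 with h1 | h1
          · exact h1
          · exact absurd hs.1 (not_lt.2 h1)
        push_cast at ht
        linarith
      rw [← ih _ this, hsucc k]
  refine ⟨y (n + 1), hlip _, ?_, fun t ht => ?_⟩
  · simp [hsucc, Φ]
  · rw [← hstab (n + 1) t, hsucc (n + 1)]
    · simp only [Φ, max_eq_left ht.1]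
    · have : ((n + 1 : ℕ) : ℝ) * h = 1 := by
        rw [hh]; push_cast; field_simp
      rw [this]; exact ht.2

/-- Peano's theorem for a bounded measurable field that is continuous in the space variable on an
open set: there is a curve that solves the equation as long as it has not left this set. -/
theorem exists_solution_until_exit [FiniteDimensional ℝ E] [MeasurableSpace E] [BorelSpace E]
    {F : ℝ → E → E} (hF : Measurable (Function.uncurry F)) {D : ℝ}
    (hD : ∀ t x, ‖F t x‖ ≤ D) (x : E) {U : Set E} (hU : IsOpen U)
    (hc : ∀ t ∈ Icc (0 : ℝ) 1, ContinuousOn (F t) U) :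
    ∃ z : ℝ → E, Continuous z ∧ z 0 = x ∧
      ∀ τ ∈ Icc (0 : ℝ) 1, (∀ s ∈ Ico 0 τ, z s ∈ U) →
        z τ = x + ∫ s in (0 : ℝ)..τ, F s (z s) := by
  have : ProperSpace E := FiniteDimensional.proper ℝ E
  have hD0 : 0 ≤ D := (norm_nonneg _).trans (hD 0 0)
  choose y hlip hy0 hy using exists_delayed_solution hF hD x
  have hylip : ∀ n, LipschitzWith ⟨D, hD0⟩ (y n) := fun n =>
    LipschitzWith.of_dist_le_mul fun s t => by
      rw [dist_eq_norm, Real.dist_eq]; exact hlip n t s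
  let f : ℕ → BoundedContinuousFunction (Icc (0 : ℝ) 1) E := fun n =>
    BoundedContinuousFunction.mkOfCompact
      ⟨fun t => y n t, (hylip n).continuous.comp continuous_subtype_val⟩
  have hcomp : IsCompact (closure (range f)) := by
    refine BoundedContinuousFunction.arzela_ascoli (Metric.closedBall x D)
      (isCompact_closedBall x D) _ ?_ ?_
    · rintro _ t ⟨n, rfl⟩
      have h := hlip n 0 t
      rw [hy0, sub_zero, abs_of_nonneg t.2.1] at h
      rw [mem_closedBall_iff_norm]
      exact h.trans (mul_le_of_le_one_right hD0 t.2.2)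
    · refine (LipschitzWith.uniformEquicontinuous _ ⟨D, hD0⟩ ?_).equicontinuous
      rintro ⟨_, n, rfl⟩
      exact LipschitzWith.of_dist_le_mul fun s t => (hylip n).dist_le_mul s t
  obtain ⟨g, -, φ, hφ, hg⟩ := hcomp.tendsto_subseq
    (x := f) (fun n => subset_closure (mem_range_self n))
  have hpt : ∀ t : Icc (0 : ℝ) 1, Tendsto (fun n => y (φ n) t) atTop (𝓝 (g t)) := fun t =>
    ((continuous_eval_const t).tendsto g).comp hg
  let z : ℝ → E := IccExtend zero_le_one g
  have hz : ∀ t ∈ Icc (0 : ℝ) 1, Tendsto (fun n => y (φ n) t) atTop (𝓝 (z t)) := by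
    intro t ht
    simp only [z, IccExtend_of_mem zero_le_one g ht]
    exact hpt ⟨t, ht⟩
  have hzc : Continuous z := g.continuous.Icc_extend'
  have hdelay : ∀ t ∈ Icc (0 : ℝ) 1,
      Tendsto (fun n => y (φ n) (t - 1 / ((φ n : ℝ) + 1))) atTop (𝓝 (z t)) := by
    intro t ht
    have h0 : Tendsto (fun n => D * |(t - 1 / ((φ n : ℝ) + 1)) - t|) atTop (𝓝 0) := by
      have h := (((tendsto_one_div_add_atTop_nhds_zero_nat (𝕜 := ℝ)).comp
        hφ.tendsto_atTop).norm).const_mul D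
      simp only [norm_zero, mul_zero] at h
      refine h.congr fun n => ?_
      simp [Real.norm_eq_abs]
    have h1 : Tendsto (fun n => y (φ n) (t - 1 / ((φ n : ℝ) + 1)) - y (φ n) t) atTop (𝓝 0) :=
      squeeze_zero_norm (fun n => hlip (φ n) t _) h0
    simpa using h1.add (hz t ht)
  refine ⟨z, hzc, ?_, fun τ hτ hin => ?_⟩
  · exact tendsto_nhds_unique (hz 0 (by simp)) (by simp [hy0])
  · refine tendsto_nhds_unique (hz τ hτ) ?_
    simp_rw [fun n => hy (φ n) τ hτ]
    refine Tendsto.const_add x ?_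
    refine intervalIntegral.tendsto_integral_filter_of_dominated_convergence (fun _ => D)
      (Eventually.of_forall fun n => ?_) (Eventually.of_forall fun n =>
        Eventually.of_forall fun s _ => hD _ _) intervalIntegrable_const ?_
    · exact (hF.comp (measurable_id.prodMk ((hylip (φ n)).continuous.measurable.comp
        (measurable_id.sub_const _)))).aestronglyMeasurable
    -- The limit curve is known to lie in `U` only before `τ`; at `s = τ` the integrands may fail to
    -- converge, but a point is null.
    · have hne : ∀ᵐ s : ℝ, s ≠ τ := by simp [ae_iff, measure_singleton]
      filter_upwards [hne] with s hs hsτ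
      rw [uIoc_of_le hτ.1] at hsτ
      have hsU : z s ∈ U := hin s ⟨hsτ.1.le, lt_of_le_of_ne hsτ.2 hs⟩
      have hs1 : s ∈ Icc (0 : ℝ) 1 := ⟨hsτ.1.le, hsτ.2.trans hτ.2⟩
      exact ((hc s hs1).continuousAt (hU.mem_nhds hsU)).tendsto.comp (hdelay s hs1)

end Peano

/-! ### Regular densities, the kernel and bounds on the velocity. -/

variable {d : ℕ} {Ω : Set (EuclideanSpace ℝ (Fin d))} {p p₀ p₁ : EuclideanSpace ℝ (Fin d) → ℝ}

namespace IsRegularDensityOn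

theorem nonneg (h : IsRegularDensityOn Ω p) (x : EuclideanSpace ℝ (Fin d)) : 0 ≤ p x := by
  obtain ⟨c, hc, hle⟩ := h.bounded_away
  by_cases hx : x ∈ Ω
  · exact hc.le.trans (hle x hx)
  · exact (h.eq_zero_off x hx).ge

theorem mem_of_ne_zero (h : IsRegularDensityOn Ω p) {x : EuclideanSpace ℝ (Fin d)}
    (hx : p x ≠ 0) : x ∈ Ω := by
  by_contra hx'
  exact hx (h.eq_zero_off x hx')

theorem exists_le (h : IsRegularDensityOn Ω p) (hΩ : IsCompact Ω) :
    ∃ M, 0 ≤ M ∧ ∀ x, p x ≤ M := by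
  obtain ⟨M, hM⟩ := (hΩ.image_of_continuousOn h.continuousOn).bddAbove
  refine ⟨max M 0, le_max_right _ _, fun x => ?_⟩
  by_cases hx : x ∈ Ω
  · exact (hM (mem_image_of_mem p hx)).trans (le_max_left _ _)
  · exact (h.eq_zero_off x hx).le.trans (le_max_right _ _)

theorem measurable (h : IsRegularDensityOn Ω p) (hΩ : IsCompact Ω) : Measurable p := by
  classical
  have hp : p = Ω.piecewise p (fun _ => 0) := by
    ext x
    by_cases hx : x ∈ Ω
    · simp [hx]
    · simp [hx, h.eq_zero_off x hx]
  rw [hp]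
  exact h.continuousOn.measurable_piecewise continuousOn_const hΩ.measurableSet

theorem continuousAt (h : IsRegularDensityOn Ω p) {x : EuclideanSpace ℝ (Fin d)}
    (hx : x ∉ frontier Ω) : ContinuousAt p x := by
  by_cases hxi : x ∈ interior Ω
  · exact h.continuousOn.continuousAt (mem_interior_iff_mem_nhds.1 hxi)
  · have hxc : x ∈ (closure Ω)ᶜ := fun hc => hx ⟨hc, hxi⟩
    refine (continuousAt_const (y := (0 : ℝ))).congr ?_
    filter_upwards [isClosed_closure.isOpen_compl.mem_nhds hxc] with y hy
    exact (h.eq_zero_off y fun hyΩ => hy (subset_closure hyΩ)).symm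

end IsRegularDensityOn

/-- The integrand `p₀(z - tδ) p₁(z + (1-t)δ)` of `interpDensity`: the joint density of the
interpolant and the displacement. -/
def interpKernel (p₀ p₁ : EuclideanSpace ℝ (Fin d) → ℝ) (t : ℝ)
    (z δ : EuclideanSpace ℝ (Fin d)) : ℝ :=
  p₀ (z - t • δ) * p₁ (z + (1 - t) • δ)

theorem interpKernel_nonneg (h₀ : IsRegularDensityOn Ω p₀) (h₁ : IsRegularDensityOn Ω p₁)
    (t : ℝ) (z δ : EuclideanSpace ℝ (Fin d)) : 0 ≤ interpKernel p₀ p₁ t z δ :=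
  mul_nonneg (h₀.nonneg _) (h₁.nonneg _)

theorem mem_of_interpKernel_ne_zero (h₀ : IsRegularDensityOn Ω p₀)
    (h₁ : IsRegularDensityOn Ω p₁) {t : ℝ} {z δ : EuclideanSpace ℝ (Fin d)}
    (h : interpKernel p₀ p₁ t z δ ≠ 0) : z - t • δ ∈ Ω ∧ z + (1 - t) • δ ∈ Ω :=
  ⟨h₀.mem_of_ne_zero (left_ne_zero_of_mul h), h₁.mem_of_ne_zero (right_ne_zero_of_mul h)⟩

theorem norm_le_diam_of_mem (hΩ : IsCompact Ω) {t : ℝ} {z δ : EuclideanSpace ℝ (Fin d)}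
    (h₀ : z - t • δ ∈ Ω) (h₁ : z + (1 - t) • δ ∈ Ω) : ‖δ‖ ≤ Metric.diam Ω := by
  have h := Metric.dist_le_diam_of_mem hΩ.isBounded h₁ h₀
  have e : z + (1 - t) • δ - (z - t • δ) = δ := by module
  rwa [dist_eq_norm, e] at h

theorem norm_le_diam_of_interpKernel_ne_zero (hΩ : IsCompact Ω)
    (h₀ : IsRegularDensityOn Ω p₀) (h₁ : IsRegularDensityOn Ω p₁) {t : ℝ}
    {z δ : EuclideanSpace ℝ (Fin d)} (h : interpKernel p₀ p₁ t z δ ≠ 0) :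
    ‖δ‖ ≤ Metric.diam Ω :=
  have := mem_of_interpKernel_ne_zero h₀ h₁ h
  norm_le_diam_of_mem hΩ this.1 this.2

theorem measurable_interpKernel (hΩ : IsCompact Ω) (h₀ : IsRegularDensityOn Ω p₀)
    (h₁ : IsRegularDensityOn Ω p₁) :
    Measurable fun q : (ℝ × EuclideanSpace ℝ (Fin d)) × EuclideanSpace ℝ (Fin d) =>
      interpKernel p₀ p₁ q.1.1 q.1.2 q.2 := by
  refine ((h₀.measurable hΩ).comp ?_).mul ((h₁.measurable hΩ).comp ?_)
  · exact Continuous.measurable (by fun_prop)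
  · exact Continuous.measurable (by fun_prop)

theorem measurable_interpKernel_right (hΩ : IsCompact Ω) (h₀ : IsRegularDensityOn Ω p₀)
    (h₁ : IsRegularDensityOn Ω p₁) (t : ℝ) (z : EuclideanSpace ℝ (Fin d)) :
    Measurable (interpKernel p₀ p₁ t z) :=
  (measurable_interpKernel hΩ h₀ h₁).comp (measurable_prodMk_left (x := (t, z)))

/-- An integrable bound, uniform in `t` and `z`, for the integrands built from `interpKernel`. -/
theorem exists_integrable_bound (hΩ : IsCompact Ω) (h₀ : IsRegularDensityOn Ω p₀)
    (h₁ : IsRegularDensityOn Ω p₁) :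
    ∃ B : EuclideanSpace ℝ (Fin d) → ℝ, Integrable B ∧
      (∀ t z δ, ‖interpKernel p₀ p₁ t z δ‖ ≤ B δ) ∧
      ∀ t z δ, ‖interpKernel p₀ p₁ t z δ • δ‖ ≤ B δ := by
  obtain ⟨M₀, hM₀, hle₀⟩ := h₀.exists_le hΩ
  obtain ⟨M₁, hM₁, hle₁⟩ := h₁.exists_le hΩ
  have hD : 0 ≤ Metric.diam Ω := Metric.diam_nonneg
  -- The kernel is at most `M₀ * M₁` and vanishes unless `‖δ‖ ≤ diam Ω`; the factor `1 + diam Ω`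
  -- covers both the kernel and its product with `δ`.
  refine ⟨(Metric.closedBall 0 (Metric.diam Ω)).indicator
    fun _ => M₀ * M₁ * (1 + Metric.diam Ω), ?_, ?_, ?_⟩
  · exact (integrable_indicator_iff Metric.isClosed_closedBall.measurableSet).2
      (integrableOn_const (isCompact_closedBall _ _).measure_lt_top.ne)
  all_goals
    intro t z δ
    by_cases h : interpKernel p₀ p₁ t z δ = 0
    · rw [h]
      simp only [zero_smul, norm_zero]
      exact indicator_nonneg (fun _ _ => by positivity) δ
    · have hδ := norm_le_diam_of_interpKernel_ne_zero hΩ h₀ h₁ h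
      rw [indicator_of_mem (by simpa using hδ)]
      have hk : ‖interpKernel p₀ p₁ t z δ‖ ≤ M₀ * M₁ := by
        rw [Real.norm_of_nonneg (interpKernel_nonneg h₀ h₁ t z δ)]
        exact mul_le_mul (hle₀ _) (hle₁ _) (h₁.nonneg _) hM₀
      have hMM : 0 ≤ M₀ * M₁ := by positivity
      have h1 : M₀ * M₁ ≤ M₀ * M₁ * (1 + Metric.diam Ω) :=
        le_mul_of_one_le_right hMM (by linarith)
      first
      | exact hk.trans h1
      | rw [norm_smul]
        exact mul_le_mul hk (by linarith) (norm_nonneg _) hMM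

theorem integrable_interpKernel (hΩ : IsCompact Ω) (h₀ : IsRegularDensityOn Ω p₀)
    (h₁ : IsRegularDensityOn Ω p₁) (t : ℝ) (z : EuclideanSpace ℝ (Fin d)) :
    Integrable (interpKernel p₀ p₁ t z) := by
  obtain ⟨B, hB, h, -⟩ := exists_integrable_bound hΩ h₀ h₁
  exact hB.mono' (measurable_interpKernel_right hΩ h₀ h₁ t z).aestronglyMeasurable
    (Eventually.of_forall (h t z))

theorem integrable_interpKernel_smul (hΩ : IsCompact Ω) (h₀ : IsRegularDensityOn Ω p₀)
    (h₁ : IsRegularDensityOn Ω p₁) (t : ℝ) (z : EuclideanSpace ℝ (Fin d)) :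
    Integrable fun δ => interpKernel p₀ p₁ t z δ • δ := by
  obtain ⟨B, hB, -, h⟩ := exists_integrable_bound hΩ h₀ h₁
  exact hB.mono' ((measurable_interpKernel_right hΩ h₀ h₁ t z).smul
    measurable_id).aestronglyMeasurable (Eventually.of_forall (h t z))

theorem interpDensity_nonneg (h₀ : IsRegularDensityOn Ω p₀) (h₁ : IsRegularDensityOn Ω p₁)
    (t : ℝ) (z : EuclideanSpace ℝ (Fin d)) : 0 ≤ interpDensity p₀ p₁ t z :=
  integral_nonneg (interpKernel_nonneg h₀ h₁ t z)

theorem norm_interpFlux_le (hΩ : IsCompact Ω) (h₀ : IsRegularDensityOn Ω p₀)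
    (h₁ : IsRegularDensityOn Ω p₁) (t : ℝ) (z : EuclideanSpace ℝ (Fin d)) :
    ‖interpFlux p₀ p₁ t z‖ ≤ interpDensity p₀ p₁ t z * Metric.diam Ω := by
  rw [interpDensity, ← integral_mul_const]
  refine norm_integral_le_of_norm_le
    ((integrable_interpKernel hΩ h₀ h₁ t z).mul_const (Metric.diam Ω))
    (Eventually.of_forall fun δ => ?_)
  change ‖interpKernel p₀ p₁ t z δ • δ‖ ≤ interpKernel p₀ p₁ t z δ * Metric.diam Ω
  have hk := interpKernel_nonneg h₀ h₁ t z δ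
  rw [norm_smul, Real.norm_of_nonneg hk]
  by_cases h : interpKernel p₀ p₁ t z δ = 0
  · simp [h]
  · exact mul_le_mul_of_nonneg_left (norm_le_diam_of_interpKernel_ne_zero hΩ h₀ h₁ h) hk

/-- Where the density vanishes, so does the flux, by `norm_interpFlux_le`; the identity therefore
survives the convention `0⁻¹ = 0` and needs no condition on `t` or `z`. -/
theorem interpDensity_smul_velocity (hΩ : IsCompact Ω) (h₀ : IsRegularDensityOn Ω p₀)
    (h₁ : IsRegularDensityOn Ω p₁) (t : ℝ) (z : EuclideanSpace ℝ (Fin d)) :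
    interpDensity p₀ p₁ t z • velocity p₀ p₁ t z = interpFlux p₀ p₁ t z := by
  by_cases h : interpDensity p₀ p₁ t z = 0
  · have hf := norm_interpFlux_le hΩ h₀ h₁ t z
    rw [h, zero_mul, norm_le_zero_iff] at hf
    rw [h, hf, zero_smul]
  · rw [velocity, smul_inv_smul₀ h]

theorem norm_velocity_le (hΩ : IsCompact Ω) (h₀ : IsRegularDensityOn Ω p₀)
    (h₁ : IsRegularDensityOn Ω p₁) (t : ℝ) (z : EuclideanSpace ℝ (Fin d)) :
    ‖velocity p₀ p₁ t z‖ ≤ Metric.diam Ω := by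
  have hd := interpDensity_nonneg h₀ h₁ t z
  rw [velocity, norm_smul, norm_inv, Real.norm_of_nonneg hd]
  rcases hd.eq_or_lt with h | h
  · rw [← h]; simpa using Metric.diam_nonneg
  · rw [inv_mul_le_iff₀ h]
    exact norm_interpFlux_le hΩ h₀ h₁ t z

theorem measurable_velocity (hΩ : IsCompact Ω) (h₀ : IsRegularDensityOn Ω p₀)
    (h₁ : IsRegularDensityOn Ω p₁) :
    Measurable fun q : ℝ × EuclideanSpace ℝ (Fin d) => velocity p₀ p₁ q.1 q.2 := by
  have hk := measurable_interpKernel hΩ h₀ h₁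
  have hd : StronglyMeasurable fun q : ℝ × EuclideanSpace ℝ (Fin d) =>
      interpDensity p₀ p₁ q.1 q.2 := hk.stronglyMeasurable.integral_prod_right'
  have hf : StronglyMeasurable fun q : ℝ × EuclideanSpace ℝ (Fin d) =>
      interpFlux p₀ p₁ q.1 q.2 :=
    (hk.smul measurable_snd).stronglyMeasurable.integral_prod_right'
  exact hd.measurable.inv.smul hf.measurable

/-- Balls around `z` inside `Ω` give a lower bound of the density, uniform in time. -/
theorem interpDensity_ge (hΩ : IsCompact Ω) (h₀ : IsRegularDensityOn Ω p₀)
    (h₁ : IsRegularDensityOn Ω p₁) {c₀ c₁ r : ℝ} (hc₁ : 0 ≤ c₁)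
    (hle₀ : ∀ x ∈ Ω, c₀ ≤ p₀ x) (hle₁ : ∀ x ∈ Ω, c₁ ≤ p₁ x)
    {t : ℝ} (ht : t ∈ Icc (0 : ℝ) 1) {z : EuclideanSpace ℝ (Fin d)}
    (hz : Metric.closedBall z r ⊆ Ω) :
    c₀ * c₁ * volume.real (Metric.closedBall (0 : EuclideanSpace ℝ (Fin d)) r)
      ≤ interpDensity p₀ p₁ t z := by
  have hm : MeasurableSet (Metric.closedBall (0 : EuclideanSpace ℝ (Fin d)) r) :=
    Metric.isClosed_closedBall.measurableSet
  have hfin : volume (Metric.closedBall (0 : EuclideanSpace ℝ (Fin d)) r) ≠ ⊤ :=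
    (isCompact_closedBall _ _).measure_lt_top.ne
  have hcalc : c₀ * c₁ * volume.real (Metric.closedBall (0 : EuclideanSpace ℝ (Fin d)) r) =
      ∫ δ, (Metric.closedBall (0 : EuclideanSpace ℝ (Fin d)) r).indicator
        (fun _ => c₀ * c₁) δ := by
    rw [integral_indicator hm, setIntegral_const, smul_eq_mul, mul_comm]
  rw [hcalc]
  refine integral_mono ((integrable_indicator_iff hm).2 (integrableOn_const hfin))
    (integrable_interpKernel hΩ h₀ h₁ t z) fun δ => ?_
  change _ ≤ interpKernel p₀ p₁ t z δ
  by_cases hδ : δ ∈ Metric.closedBall (0 : EuclideanSpace ℝ (Fin d)) r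
  · rw [indicator_of_mem hδ]
    rw [mem_closedBall_zero_iff] at hδ
    have hscale : ∀ s : ℝ, |s| ≤ 1 → ‖s • δ‖ ≤ r := fun s hs => by
      rw [norm_smul, Real.norm_eq_abs]
      exact (mul_le_of_le_one_left (norm_nonneg _) hs).trans hδ
    have ha : z - t • δ ∈ Ω := hz (by
      rw [mem_closedBall_iff_norm, sub_sub_cancel_left, norm_neg]
      exact hscale t (by rw [abs_of_nonneg ht.1]; exact ht.2))
    have hb : z + (1 - t) • δ ∈ Ω := hz (by
      rw [mem_closedBall_iff_norm, add_sub_cancel_left]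
      exact hscale (1 - t) (by rw [abs_of_nonneg (by linarith [ht.2])]; linarith [ht.1]))
    exact mul_le_mul (hle₀ _ ha) (hle₁ _ hb) hc₁ (h₀.nonneg _)
  · rw [indicator_of_notMem hδ]
    exact interpKernel_nonneg h₀ h₁ t z δ

theorem interpDensity_pos (hΩ : IsCompact Ω) (h₀ : IsRegularDensityOn Ω p₀)
    (h₁ : IsRegularDensityOn Ω p₁) {t : ℝ} (ht : t ∈ Icc (0 : ℝ) 1)
    {z : EuclideanSpace ℝ (Fin d)} (hz : z ∈ interior Ω) : 0 < interpDensity p₀ p₁ t z := by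
  obtain ⟨c₀, hc₀, hle₀⟩ := h₀.bounded_away
  obtain ⟨c₁, hc₁, hle₁⟩ := h₁.bounded_away
  obtain ⟨r, hr, hball⟩ := Metric.nhds_basis_closedBall.mem_iff.1
    (mem_interior_iff_mem_nhds.1 hz)
  refine lt_of_lt_of_le ?_
    (interpDensity_ge hΩ h₀ h₁ hc₁.le hle₀ hle₁ ht hball)
  have : 0 < volume.real (Metric.closedBall (0 : EuclideanSpace ℝ (Fin d)) r) :=
    ENNReal.toReal_pos (Metric.measure_closedBall_pos _ _ hr).ne'
      (isCompact_closedBall _ _).measure_lt_top.ne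
  positivity

/-! ### Continuity of the velocity in the interior. -/

theorem ae_add_smul_notMem {S : Set (EuclideanSpace ℝ (Fin d))} (hS : volume S = 0)
    {r : ℝ} (hr : r ≠ 0) (z : EuclideanSpace ℝ (Fin d)) :
    ∀ᵐ δ, z + r • δ ∉ S := by
  rw [ae_iff]
  simp only [not_not]
  have h : {δ | z + r • δ ∈ S} = (fun δ => r • δ) ⁻¹' ((fun y => z + y) ⁻¹' S) := rfl
  rw [h, Measure.addHaar_preimage_smul _ hr, measure_preimage_add, hS, mul_zero]

/-- The boundary of a convex set is null, and `δ ↦ z - tδ` pulls null sets back to null sets when `t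
≠ 0`. When `t = 0` this endpoint is `z` itself, which is interior. The other endpoint is symmetric,
with `t = 1` exceptional. -/
theorem ae_continuousAt_interpKernel (hΩ : Convex ℝ Ω) (h₀ : IsRegularDensityOn Ω p₀)
    (h₁ : IsRegularDensityOn Ω p₁) {t : ℝ} {z : EuclideanSpace ℝ (Fin d)}
    (hz : z ∈ interior Ω) :
    ∀ᵐ δ, ContinuousAt
      (fun q : ℝ × EuclideanSpace ℝ (Fin d) => interpKernel p₀ p₁ q.1 q.2 δ) (t, z) := by
  have hfr : volume (frontier Ω) = 0 := hΩ.addHaar_frontier volume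
  have hz' : z ∉ frontier Ω := fun h => h.2 hz
  have ha : ∀ᵐ δ, z - t • δ ∉ frontier Ω := by
    by_cases ht : t = 0
    · simpa [ht] using hz'
    · filter_upwards [ae_add_smul_notMem hfr (neg_ne_zero.2 ht) z] with δ hδ
      rwa [neg_smul, ← sub_eq_add_neg] at hδ
  have hb : ∀ᵐ δ, z + (1 - t) • δ ∉ frontier Ω := by
    by_cases ht : 1 - t = 0
    · simpa [ht] using hz'
    · exact ae_add_smul_notMem hfr ht z
  filter_upwards [ha, hb] with δ hδ₀ hδ₁
  refine ContinuousAt.mul ?_ ?_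
  · exact ContinuousAt.comp (f := fun q : ℝ × EuclideanSpace ℝ (Fin d) => q.2 - q.1 • δ)
      (x := (t, z)) (h₀.continuousAt hδ₀) (by fun_prop)
  · exact ContinuousAt.comp
      (f := fun q : ℝ × EuclideanSpace ℝ (Fin d) => q.2 + (1 - q.1) • δ)
      (x := (t, z)) (h₁.continuousAt hδ₁) (by fun_prop)

/-- The velocity field is jointly continuous at the points of `[0, 1] × interior Ω`. -/
theorem continuousAt_velocity (hΩ : IsCompact Ω) (hconv : Convex ℝ Ω)
    (h₀ : IsRegularDensityOn Ω p₀) (h₁ : IsRegularDensityOn Ω p₁) {t : ℝ}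
    (ht : t ∈ Icc (0 : ℝ) 1) {z : EuclideanSpace ℝ (Fin d)} (hz : z ∈ interior Ω) :
    ContinuousAt (fun q : ℝ × EuclideanSpace ℝ (Fin d) => velocity p₀ p₁ q.1 q.2) (t, z) := by
  obtain ⟨B, hB, hb, hb'⟩ := exists_integrable_bound hΩ h₀ h₁
  have hk := ae_continuousAt_interpKernel hconv h₀ h₁ (t := t) hz
  have hd : ContinuousAt
      (fun q : ℝ × EuclideanSpace ℝ (Fin d) => interpDensity p₀ p₁ q.1 q.2) (t, z) :=
    continuousAt_of_dominated (Eventually.of_forall fun q =>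
      (measurable_interpKernel_right hΩ h₀ h₁ q.1 q.2).aestronglyMeasurable)
      (Eventually.of_forall fun q => Eventually.of_forall (hb q.1 q.2)) hB hk
  have hf : ContinuousAt
      (fun q : ℝ × EuclideanSpace ℝ (Fin d) => interpFlux p₀ p₁ q.1 q.2) (t, z) :=
    continuousAt_of_dominated (Eventually.of_forall fun q =>
      ((measurable_interpKernel_right hΩ h₀ h₁ q.1 q.2).smul
        measurable_id).aestronglyMeasurable)
      (Eventually.of_forall fun q => Eventually.of_forall (hb' q.1 q.2)) hB
      (hk.mono fun δ hδ => hδ.smul continuousAt_const)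
  exact (hd.inv₀ (interpDensity_pos hΩ h₀ h₁ ht hz).ne').smul hf

theorem continuousOn_velocity (hΩ : IsCompact Ω) (hconv : Convex ℝ Ω)
    (h₀ : IsRegularDensityOn Ω p₀) (h₁ : IsRegularDensityOn Ω p₁) {t : ℝ}
    (ht : t ∈ Icc (0 : ℝ) 1) : ContinuousOn (velocity p₀ p₁ t) (interior Ω) :=
  fun z hz => (ContinuousAt.comp (f := fun z => (t, z)) (x := z)
    (continuousAt_velocity hΩ hconv h₀ h₁ ht hz) (by fun_prop)).continuousWithinAt

/-! ### Confinement to the interior before time `1`. -/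

/-- The endpoint `z + (1 - t) v(t, z)` lies in every half-space containing `Ω`. -/
theorem velocity_halfSpace_le (hΩ : IsCompact Ω) (h₀ : IsRegularDensityOn Ω p₀)
    (h₁ : IsRegularDensityOn Ω p₁) {t : ℝ} (ht : t ∈ Icc (0 : ℝ) 1)
    {z : EuclideanSpace ℝ (Fin d)} (hz : z ∈ interior Ω)
    (l : StrongDual ℝ (EuclideanSpace ℝ (Fin d))) {b : ℝ} (hb : ∀ y ∈ Ω, l y ≤ b) :
    (1 - t) * l (velocity p₀ p₁ t z) ≤ b - l z := by
  have hpos := interpDensity_pos hΩ h₀ h₁ ht hz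
  have hi := integrable_interpKernel_smul hΩ h₀ h₁ t z
  have hflux : l (interpFlux p₀ p₁ t z) = ∫ δ, interpKernel p₀ p₁ t z δ * l δ := by
    have h := l.integral_comp_comm hi
    simp only [map_smul, smul_eq_mul] at h
    exact h.symm
  have hli : Integrable fun δ => interpKernel p₀ p₁ t z δ * l δ := by
    have h := l.integrable_comp hi
    simpa only [map_smul, smul_eq_mul] using h
  -- Where the kernel is non-zero, `z + (1-t)δ ∈ Ω` gives `(1-t) l δ ≤ b - l z`; integrate this
  -- against the kernel.
  have hmain : (1 - t) * l (interpFlux p₀ p₁ t z) ≤ interpDensity p₀ p₁ t z * (b - l z) := by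
    rw [hflux, interpDensity, ← integral_const_mul, ← integral_mul_const]
    refine integral_mono (hli.const_mul _)
      ((integrable_interpKernel hΩ h₀ h₁ t z).mul_const _) fun δ => ?_
    change (1 - t) * (interpKernel p₀ p₁ t z δ * l δ) ≤ interpKernel p₀ p₁ t z δ * (b - l z)
    by_cases h : interpKernel p₀ p₁ t z δ = 0
    · simp [h]
    · have hm := hb _ (mem_of_interpKernel_ne_zero h₀ h₁ h).2
      rw [map_add, map_smul, smul_eq_mul] at hm
      have := mul_le_mul_of_nonneg_left (a := interpKernel p₀ p₁ t z δ)
        (by linarith : (1 - t) * l δ ≤ b - l z) (interpKernel_nonneg h₀ h₁ t z δ)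
      linarith
  rw [velocity, map_smul, smul_eq_mul, mul_left_comm, inv_mul_le_iff₀ hpos]
  exact hmain

/-- A solution that stays in `interior Ω` on `[0, τ)` with `τ < 1` is still there at time `τ`. -/
theorem mem_interior_of_solution (hΩ : IsCompact Ω) (hconv : Convex ℝ Ω)
    (h₀ : IsRegularDensityOn Ω p₀) (h₁ : IsRegularDensityOn Ω p₁)
    {x : EuclideanSpace ℝ (Fin d)} (hx : x ∈ interior Ω) {τ : ℝ} (hτ0 : 0 ≤ τ) (hτ1 : τ < 1)
    {z : ℝ → EuclideanSpace ℝ (Fin d)} (hzc : ContinuousOn z (Icc 0 τ))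
    (hz : ∀ t ∈ Icc 0 τ, z t = x + ∫ s in (0 : ℝ)..t, velocity p₀ p₁ s (z s))
    (hin : ∀ t ∈ Ico 0 τ, z t ∈ interior Ω) : z τ ∈ interior Ω := by
  have hz0 : z 0 = x := by simpa using hz 0 ⟨le_rfl, hτ0⟩
  rcases hτ0.eq_or_lt with rfl | hτpos
  · rwa [hz0]
  have hvc : ContinuousOn (fun s => velocity p₀ p₁ s (z s)) (Ico 0 τ) := by
    intro s hs
    have hc := continuousAt_velocity hΩ hconv h₀ h₁ (t := s)
      ⟨hs.1, hs.2.le.trans hτ1.le⟩ (hin s hs)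
    exact ContinuousAt.comp_continuousWithinAt (f := fun s => (s, z s)) (x := s) hc
      (continuousWithinAt_id.prodMk ((hzc s ⟨hs.1, hs.2.le⟩).mono Ico_subset_Icc_self))
  have hder : ∀ t ∈ Ioo 0 τ, HasDerivAt z (velocity p₀ p₁ t (z t)) t := by
    intro t ht
    have h1 : HasDerivAt (fun u => ∫ s in (0 : ℝ)..u, velocity p₀ p₁ s (z s))
        (velocity p₀ p₁ t (z t)) t := by
      refine intervalIntegral.integral_hasDerivAt_right ?_ ?_ ?_
      · refine ContinuousOn.intervalIntegrable_of_Icc ht.1.le (hvc.mono ?_)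
        exact fun s hs => ⟨hs.1, hs.2.trans_lt ht.2⟩
      · exact ContinuousOn.stronglyMeasurableAtFilter isOpen_Ioo
          (hvc.mono Ioo_subset_Ico_self) t ht
      · exact (hvc.mono Ioo_subset_Ico_self).continuousAt (isOpen_Ioo.mem_nhds ht)
    refine (h1.const_add x).congr_of_eventuallyEq ?_
    filter_upwards [isOpen_Ioo.mem_nhds ht] with u hu
    exact hz u (Ioo_subset_Icc_self hu)
  have hhalf : ∀ (l : StrongDual ℝ (EuclideanSpace ℝ (Fin d))) (b : ℝ), (∀ y ∈ Ω, l y ≤ b) →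
      l (z τ) ≤ τ * b + (1 - τ) * l x := by
    intro l b hb
    -- The numerator of the derivative is `b - l(z) - (1-t) l(v)`, non-negative by
    -- `velocity_halfSpace_le`. Comparing times `0` and `τ` gives the claim.
    have hmono : MonotoneOn (fun t => (b - l (z t)) * (1 - t)⁻¹) (Icc 0 τ) := by
      have hne : ∀ t ∈ Icc 0 τ, 1 - t ≠ 0 := fun t ht => by
        have := ht.2.trans_lt hτ1
        exact (sub_pos.2 this).ne'
      have hderiv : ∀ t ∈ Ioo 0 τ, HasDerivAt (fun t => (b - l (z t)) * (1 - t)⁻¹)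
          (-(l (velocity p₀ p₁ t (z t))) * (1 - t)⁻¹ +
            (b - l (z t)) * (-(-1) / (1 - t) ^ 2)) t := by
        intro t ht
        exact ((l.hasFDerivAt.comp_hasDerivAt t (hder t ht)).const_sub b).mul
          (((hasDerivAt_id t).const_sub 1).inv (hne t (Ioo_subset_Icc_self ht)))
      refine monotoneOn_of_deriv_nonneg (convex_Icc _ _) ?_ ?_ ?_
      · refine ContinuousOn.mul (continuousOn_const.sub (l.continuous.comp_continuousOn hzc)) ?_
        exact (continuousOn_const.sub continuousOn_id).inv₀ hne
      · rw [interior_Icc]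
        exact fun t ht => (hderiv t ht).differentiableAt.differentiableWithinAt
      · rw [interior_Icc]
        intro t ht
        rw [(hderiv t ht).deriv]
        have hpos : 0 < 1 - t := by linarith [ht.2]
        have hv := velocity_halfSpace_le hΩ h₀ h₁ (t := t)
          ⟨ht.1.le, by linarith [ht.2]⟩ (hin t (Ioo_subset_Ico_self ht)) l hb
        have : -(l (velocity p₀ p₁ t (z t))) * (1 - t)⁻¹ +
            (b - l (z t)) * (-(-1) / (1 - t) ^ 2) =
            ((b - l (z t)) - (1 - t) * l (velocity p₀ p₁ t (z t))) / (1 - t) ^ 2 := by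
          field_simp
          ring
        rw [this]
        exact div_nonneg (by linarith) (by positivity)
    have h := hmono ⟨le_rfl, hτ0⟩ ⟨hτ0, le_rfl⟩ hτ0
    have hpos : 0 < 1 - τ := by linarith
    simp only [hz0, sub_zero, inv_one, mul_one] at h
    rw [← div_eq_mul_inv, le_div_iff₀ hpos] at h
    linarith
  -- This is the point `w` with `z τ = (1-τ) x + τ w`. It satisfies every half-space bound valid on
  -- `Ω`, so Hahn–Banach puts it in `Ω`; since `x` is interior and `τ < 1`, so is `z τ`.
  have hw : τ⁻¹ • (z τ - (1 - τ) • x) ∈ Ω := by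
    by_contra hw
    obtain ⟨l, b, hlb, hbl⟩ := geometric_hahn_banach_closed_point hconv hΩ.isClosed hw
    have h := hhalf l b fun y hy => (hlb y hy).le
    rw [map_smul, map_sub, map_smul, smul_eq_mul, smul_eq_mul, lt_inv_mul_iff₀ hτpos] at hbl
    linarith
  have h := hconv.combo_interior_self_mem_interior hx hw (sub_pos.2 hτ1) hτ0 (by ring)
  rwa [smul_inv_smul₀ hτpos.ne', add_sub_cancel] at h

/-! ### Modulus of continuity of the velocity. -/

theorem densityModulus_nonneg (η : ℝ) : 0 ≤ densityModulus Ω p₀ p₁ η :=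
  Real.sSup_nonneg (by
    rintro _ ⟨z, -, z', -, -, rfl⟩
    exact le_max_of_le_left (abs_nonneg _))

/-- Guards against the default value of `sSup`: without this bound the supremum in `densityModulus`
could be `0` and dominate nothing. -/
theorem IsRegularDensityOn.exists_abs_div_sub_one_le (h : IsRegularDensityOn Ω p)
    (hΩ : IsCompact Ω) : ∃ K, ∀ z ∈ Ω, ∀ z' ∈ Ω, |p z / p z' - 1| ≤ K := by
  obtain ⟨c, hc, hle⟩ := h.bounded_away
  obtain ⟨M, hM, hpM⟩ := h.exists_le hΩ
  refine ⟨M / c + 1, fun z _ z' hz' => ?_⟩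
  have h1 : 0 ≤ p z / p z' := div_nonneg (h.nonneg _) (h.nonneg _)
  have h2 : p z / p z' ≤ M / c := div_le_div₀ hM (hpM z) hc (hle z' hz')
  rw [abs_le]
  constructor <;> linarith

theorem max_abs_div_sub_one_le_densityModulus (hΩ : IsCompact Ω)
    (h₀ : IsRegularDensityOn Ω p₀) (h₁ : IsRegularDensityOn Ω p₁) {η : ℝ}
    {z z' : EuclideanSpace ℝ (Fin d)} (hz : z ∈ Ω) (hz' : z' ∈ Ω) (hη : ‖z - z'‖ ≤ η) :
    max |p₀ z / p₀ z' - 1| |p₁ z / p₁ z' - 1| ≤ densityModulus Ω p₀ p₁ η := by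
  obtain ⟨K₀, hK₀⟩ := h₀.exists_abs_div_sub_one_le hΩ
  obtain ⟨K₁, hK₁⟩ := h₁.exists_abs_div_sub_one_le hΩ
  refine le_csSup ⟨max K₀ K₁, ?_⟩ ⟨z, hz, z', hz', hη, rfl⟩
  rintro _ ⟨y, hy, y', hy', -, rfl⟩
  exact max_le_max (hK₀ y hy y' hy') (hK₁ y hy y' hy')

theorem IsRegularDensityOn.abs_sub_le (h : IsRegularDensityOn Ω p) {z z' : EuclideanSpace ℝ (Fin d)}
    (hz' : z' ∈ Ω) {M w : ℝ} (hM : ∀ x, p x ≤ M) (hw : |p z / p z' - 1| ≤ w) :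
    |p z - p z'| ≤ M * w := by
  obtain ⟨c, hc, hle⟩ := h.bounded_away
  have hpos : 0 < p z' := hc.trans_le (hle z' hz')
  have e : p z - p z' = p z' * (p z / p z' - 1) := by field_simp
  rw [e, abs_mul, abs_of_pos hpos]
  exact mul_le_mul (hM z') hw (abs_nonneg _) (hpos.le.trans (hM z'))

/-- The displacements `δ` with both endpoints `z - tδ` and `z + (1-t)δ` in `Ω`. -/
def admissible (Ω : Set (EuclideanSpace ℝ (Fin d))) (t : ℝ) (z : EuclideanSpace ℝ (Fin d)) :
    Set (EuclideanSpace ℝ (Fin d)) :=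
  {δ | z - t • δ ∈ Ω ∧ z + (1 - t) • δ ∈ Ω}

theorem admissible_subset_closedBall (hΩ : IsCompact Ω) (t : ℝ)
    (z : EuclideanSpace ℝ (Fin d)) :
    admissible Ω t z ⊆ Metric.closedBall 0 (Metric.diam Ω) := fun δ hδ => by
  rw [mem_closedBall_zero_iff]
  exact norm_le_diam_of_mem hΩ hδ.1 hδ.2

theorem isCompact_admissible (hΩ : IsCompact Ω) (t : ℝ) (z : EuclideanSpace ℝ (Fin d)) :
    IsCompact (admissible Ω t z) := by
  refine (isCompact_closedBall 0 (Metric.diam Ω)).of_isClosed_subset ?_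
    (admissible_subset_closedBall hΩ t z)
  exact (hΩ.isClosed.preimage (by fun_prop : Continuous fun δ => z - t • δ)).inter
    (hΩ.isClosed.preimage (by fun_prop : Continuous fun δ => z + (1 - t) • δ))

theorem volume_admissible_le (hΩ : IsCompact Ω) (t : ℝ) (z : EuclideanSpace ℝ (Fin d)) :
    volume.real (admissible Ω t z) ≤
      volume.real (Metric.closedBall (0 : EuclideanSpace ℝ (Fin d)) (Metric.diam Ω)) :=
  measureReal_mono (admissible_subset_closedBall hΩ t z)
    (isCompact_closedBall _ _).measure_lt_top.ne

/-- The endpoints of `(1-s)δ` seen from `z + su` are the convex combinations, with weight `s` on `z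
+ u`, of `z + u` with the endpoints of `δ` seen from `z`. -/
theorem smul_mem_admissible (hconv : Convex ℝ Ω) {t s : ℝ} (hs0 : 0 ≤ s) (hs1 : s ≤ 1)
    {z u δ : EuclideanSpace ℝ (Fin d)} (hu : z + u ∈ Ω) (hδ : δ ∈ admissible Ω t z) :
    (1 - s) • δ ∈ admissible Ω t (z + s • u) := by
  constructor
  · convert hconv hδ.1 hu (sub_nonneg.2 hs1) hs0 (by ring) using 1
    module
  · convert hconv hδ.2 hu (sub_nonneg.2 hs1) hs0 (by ring) using 1
    module

open scoped Pointwise in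
/-- The admissible sets depend on the base point in a Lipschitz way, locally in `interior Ω`. -/
theorem volume_admissible_diff_le (hΩ : IsCompact Ω) (hconv : Convex ℝ Ω) {t r : ℝ}
    (hr : 0 < r) {z z' : EuclideanSpace ℝ (Fin d)} (hball : Metric.closedBall z r ⊆ Ω)
    (hzz' : ‖z' - z‖ ≤ r) :
    volume.real (admissible Ω t z \ admissible Ω t z') ≤ d * (‖z' - z‖ / r) *
      volume.real (Metric.closedBall (0 : EuclideanSpace ℝ (Fin d)) (Metric.diam Ω)) := by
  set A := admissible Ω t z with hA
  set s := ‖z' - z‖ / r with hs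
  have hs0 : 0 ≤ s := by positivity
  have hs1 : s ≤ 1 := (div_le_one hr).2 hzz'
  have hAc : IsCompact A := isCompact_admissible hΩ t z
  -- Extend the step from `z` to `z'` to length `r`: `z'` lies at the fraction `s` of the way to a
  -- point `z + u` still in `Ω`. Then both `A` and the admissible set of `z'` contain `(1-s) A`, and
  -- Bernoulli's inequality bounds the lost volume.
  obtain ⟨u, hu, hz'⟩ : ∃ u, z + u ∈ Ω ∧ z' = z + s • u := by
    refine ⟨s⁻¹ • (z' - z), hball ?_, ?_⟩
    · rw [mem_closedBall_iff_norm, add_sub_cancel_left, norm_smul, norm_inv,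
        Real.norm_of_nonneg hs0]
      rcases hs0.eq_or_lt with h | h
      · rw [← h]; simpa using hr.le
      · rw [hs, inv_div, div_mul_cancel₀]
        intro h0
        rw [hs, h0, zero_div] at h
        exact h.false
    · by_cases h : s = 0
      · have h0 : ‖z' - z‖ = 0 := by
          rw [hs, div_eq_zero_iff] at h
          exact h.resolve_right hr.ne'
        rw [norm_eq_zero, sub_eq_zero] at h0
        simp [h0]
      · rw [smul_inv_smul₀ h, add_sub_cancel]
  have hzΩ : z + 0 ∈ Ω := by rw [add_zero]; exact hball (Metric.mem_closedBall_self hr.le)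
  have hBA : (1 - s) • A ⊆ A := by
    rintro _ ⟨δ, hδ, rfl⟩
    simpa using smul_mem_admissible hconv hs0 hs1 hzΩ hδ
  have hBA' : (1 - s) • A ⊆ admissible Ω t z' := by
    rintro _ ⟨δ, hδ, rfl⟩
    rw [hz']
    exact smul_mem_admissible hconv hs0 hs1 hu hδ
  have hBc : IsCompact ((1 - s) • A) := hAc.smul (1 - s)
  have hsmul : volume.real ((1 - s) • A) = (1 - s) ^ d * volume.real A := by
    rw [measureReal_def, Measure.addHaar_smul, ENNReal.toReal_mul, ENNReal.toReal_ofReal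
      (abs_nonneg _), finrank_euclideanSpace_fin, abs_of_nonneg (pow_nonneg (sub_nonneg.2 hs1) d),
      measureReal_def]
  calc volume.real (A \ admissible Ω t z')
      ≤ volume.real (A \ ((1 - s) • A)) :=
        measureReal_mono (sdiff_subset_sdiff_right hBA')
          (measure_mono sdiff_subset |>.trans_lt hAc.measure_lt_top).ne
    _ = volume.real A - (1 - s) ^ d * volume.real A := by
        rw [measureReal_sdiff hBA hBc.measurableSet hAc.measure_lt_top.ne, hsmul]
    _ ≤ d * s * volume.real A := by
        have hb := one_add_mul_le_pow (a := -s) (by linarith) d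
        rw [← sub_eq_add_neg] at hb
        have := mul_le_mul_of_nonneg_right hb (measureReal_nonneg (μ := volume) (s := A))
        linarith
    _ ≤ _ := mul_le_mul_of_nonneg_left (volume_admissible_le hΩ t z) (by positivity)

/-- If `δ` is admissible at both points, each factor varies by its maximum times `ω`, whence the
constant `2`; if at only one, a single kernel value remains, at most `M₀ * M₁`. -/
theorem abs_interpKernel_sub_le (hΩ : IsCompact Ω)
    (h₀ : IsRegularDensityOn Ω p₀) (h₁ : IsRegularDensityOn Ω p₁) {M₀ M₁ : ℝ}
    (hle₀ : ∀ x, p₀ x ≤ M₀) (hle₁ : ∀ x, p₁ x ≤ M₁) (t : ℝ)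
    (z z' δ : EuclideanSpace ℝ (Fin d)) :
    |interpKernel p₀ p₁ t z δ - interpKernel p₀ p₁ t z' δ| ≤
      (admissible Ω t z).indicator
        (fun _ => 2 * (M₀ * M₁) * densityModulus Ω p₀ p₁ ‖z - z'‖) δ +
      (admissible Ω t z \ admissible Ω t z').indicator (fun _ => M₀ * M₁) δ +
      (admissible Ω t z' \ admissible Ω t z).indicator (fun _ => M₀ * M₁) δ := by
  have hM₀ : 0 ≤ M₀ := (h₀.nonneg z).trans (hle₀ z)
  have hM₁ : 0 ≤ M₁ := (h₁.nonneg z).trans (hle₁ z)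
  have hω := densityModulus_nonneg (Ω := Ω) (p₀ := p₀) (p₁ := p₁) ‖z - z'‖
  have hMM : 0 ≤ M₀ * M₁ := mul_nonneg hM₀ hM₁
  have hk : ∀ y, |interpKernel p₀ p₁ t y δ| ≤ M₀ * M₁ := fun y => by
    rw [abs_of_nonneg (interpKernel_nonneg h₀ h₁ t y δ)]
    exact mul_le_mul (hle₀ _) (hle₁ _) (h₁.nonneg _) hM₀
  have hzero : ∀ y, δ ∉ admissible Ω t y → interpKernel p₀ p₁ t y δ = 0 := fun y hy => by
    by_contra h
    exact hy (mem_of_interpKernel_ne_zero h₀ h₁ h)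
  by_cases hz : δ ∈ admissible Ω t z <;> by_cases hz' : δ ∈ admissible Ω t z'
  · simp only [indicator, hz, hz', Set.mem_sdiff, not_true, and_false, if_true, if_false, add_zero]
    have hm : ∀ u : EuclideanSpace ℝ (Fin d), z + u ∈ Ω → z' + u ∈ Ω →
        |p₀ (z + u) - p₀ (z' + u)| ≤ M₀ * densityModulus Ω p₀ p₁ ‖z - z'‖ ∧
        |p₁ (z + u) - p₁ (z' + u)| ≤ M₁ * densityModulus Ω p₀ p₁ ‖z - z'‖ := fun u hu hu' => by
      have h := max_abs_div_sub_one_le_densityModulus hΩ h₀ h₁ hu hu' (η := ‖z - z'‖)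
        (by rw [add_sub_add_right_eq_sub])
      exact ⟨h₀.abs_sub_le hu' hle₀ ((le_max_left _ _).trans h),
        h₁.abs_sub_le hu' hle₁ ((le_max_right _ _).trans h)⟩
    have ha := (hm (-(t • δ)) (by rw [← sub_eq_add_neg]; exact hz.1)
      (by rw [← sub_eq_add_neg]; exact hz'.1)).1
    have hb := (hm ((1 - t) • δ) hz.2 hz'.2).2
    rw [← sub_eq_add_neg, ← sub_eq_add_neg] at ha
    have e : interpKernel p₀ p₁ t z δ - interpKernel p₀ p₁ t z' δ =
        (p₀ (z - t • δ) - p₀ (z' - t • δ)) * p₁ (z + (1 - t) • δ) +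
        p₀ (z' - t • δ) * (p₁ (z + (1 - t) • δ) - p₁ (z' + (1 - t) • δ)) := by
      simp only [interpKernel]; ring
    rw [e]
    refine (abs_add_le _ _).trans ?_
    rw [abs_mul, abs_mul, abs_of_nonneg (h₁.nonneg _), abs_of_nonneg (h₀.nonneg _)]
    have h1 := mul_le_mul ha (hle₁ (z + (1 - t) • δ)) (h₁.nonneg _) (mul_nonneg hM₀ hω)
    have h2 := mul_le_mul (hle₀ (z' - t • δ)) hb (abs_nonneg _) hM₀
    linarith
  · simp only [indicator, hz, hz', Set.mem_sdiff, not_false_eq_true, and_true, if_true, if_false,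
      add_zero, and_false, hzero z' hz', sub_zero, not_true]
    have := hk z
    have : 0 ≤ 2 * (M₀ * M₁) * densityModulus Ω p₀ p₁ ‖z - z'‖ := by positivity
    linarith
  · simp only [indicator, hz, hz', Set.mem_sdiff, not_false_eq_true, and_true, if_true, if_false,
      zero_add, add_zero, and_false, hzero z hz, zero_sub, not_true, abs_neg]
    exact hk z'
  · simp [indicator, hz, hz', hzero z hz, hzero z' hz']

theorem integral_abs_interpKernel_sub_le (hΩ : IsCompact Ω) (hconv : Convex ℝ Ω)
    (h₀ : IsRegularDensityOn Ω p₀) (h₁ : IsRegularDensityOn Ω p₁) {r : ℝ} (hr : 0 < r) :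
    ∃ C, 0 ≤ C ∧ ∀ t z z', Metric.closedBall z r ⊆ Ω → Metric.closedBall z' r ⊆ Ω →
      ‖z - z'‖ ≤ r → ∫ δ, |interpKernel p₀ p₁ t z δ - interpKernel p₀ p₁ t z' δ| ≤
        C * (densityModulus Ω p₀ p₁ ‖z - z'‖ + ‖z - z'‖) := by
  obtain ⟨M₀, hM₀, hle₀⟩ := h₀.exists_le hΩ
  obtain ⟨M₁, hM₁, hle₁⟩ := h₁.exists_le hΩ
  set V := volume.real (Metric.closedBall (0 : EuclideanSpace ℝ (Fin d)) (Metric.diam Ω))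
  have hV : 0 ≤ V := measureReal_nonneg
  refine ⟨2 * (M₀ * M₁) * V * (1 + d / r), by positivity, fun t z z' hz hz' hzz' => ?_⟩
  set w := densityModulus Ω p₀ p₁ ‖z - z'‖ with hw
  have hw0 : 0 ≤ w := densityModulus_nonneg _
  have hm : ∀ y, MeasurableSet (admissible Ω t y) := fun y =>
    (isCompact_admissible hΩ t y).measurableSet
  have hfin : ∀ y, volume (admissible Ω t y) ≠ ⊤ := fun y =>
    (isCompact_admissible hΩ t y).measure_lt_top.ne
  have hfin' : ∀ y y', volume (admissible Ω t y \ admissible Ω t y') ≠ ⊤ := fun y y' =>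
    ((measure_mono sdiff_subset).trans_lt (hfin y).lt_top).ne
  have hi : ∀ (S : Set (EuclideanSpace ℝ (Fin d))) (a : ℝ), MeasurableSet S → volume S ≠ ⊤ →
      Integrable (S.indicator fun _ => a) := fun S a hS hS' =>
    (integrable_indicator_iff hS).2 (integrableOn_const hS')
  have hI : ∀ (S : Set (EuclideanSpace ℝ (Fin d))) (a : ℝ), MeasurableSet S →
      ∫ δ, S.indicator (fun _ => a) δ = volume.real S * a := fun S a hS => by
    rw [integral_indicator hS, setIntegral_const, smul_eq_mul]
  have hi1 := hi _ (2 * (M₀ * M₁) * w) (hm z) (hfin z)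
  have hi2 := hi _ (M₀ * M₁) ((hm z).diff (hm z')) (hfin' z z')
  have hi3 := hi _ (M₀ * M₁) ((hm z').diff (hm z)) (hfin' z' z)
  have hmono := integral_mono
    ((integrable_interpKernel hΩ h₀ h₁ t z).sub (integrable_interpKernel hΩ h₀ h₁ t z')).abs
    ((hi1.add hi2).add hi3) (abs_interpKernel_sub_le hΩ h₀ h₁ hle₀ hle₁ t z z')
  rw [integral_add' (hi1.add hi2) hi3, integral_add' hi1 hi2, hI _ _ (hm z),
    hI _ _ ((hm z).diff (hm z')), hI _ _ ((hm z').diff (hm z))] at hmono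
  refine hmono.trans ?_
  have hd1 := volume_admissible_diff_le hΩ hconv hr (t := t) hz
    (by rw [norm_sub_rev]; exact hzz' : ‖z' - z‖ ≤ r)
  have hd2 := volume_admissible_diff_le hΩ hconv hr (t := t) hz' hzz'
  rw [norm_sub_rev] at hd1
  have hMM : 0 ≤ M₀ * M₁ := mul_nonneg hM₀ hM₁
  have e1 := mul_le_mul_of_nonneg_right (volume_admissible_le hΩ t z)
    (by positivity : 0 ≤ 2 * (M₀ * M₁) * w)
  have e2 := mul_le_mul_of_nonneg_right hd1 hMM
  have e3 := mul_le_mul_of_nonneg_right hd2 hMM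
  have e4 : 0 ≤ 2 * (M₀ * M₁) * V * (d / r) * w := by positivity
  have e5 : 0 ≤ 2 * (M₀ * M₁) * V * ‖z - z'‖ := by positivity
  have e6 : d * (‖z - z'‖ / r) * V * (M₀ * M₁) = (M₀ * M₁) * V * (d / r) * ‖z - z'‖ := by ring
  rw [e6] at e2 e3
  linarith

/-- Locally in `interior Ω` and uniformly in time, the velocity field has modulus of continuity
`C (ω(η) + η)`. -/
theorem exists_velocity_modulus (hΩ : IsCompact Ω) (hconv : Convex ℝ Ω)
    (h₀ : IsRegularDensityOn Ω p₀) (h₁ : IsRegularDensityOn Ω p₁)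
    {x : EuclideanSpace ℝ (Fin d)} (hx : x ∈ interior Ω) :
    ∃ ρ, 0 < ρ ∧ ∃ C, 0 ≤ C ∧ ∀ t ∈ Icc (0 : ℝ) 1, ∀ z ∈ Metric.closedBall x ρ,
      ∀ z' ∈ Metric.closedBall x ρ, ‖velocity p₀ p₁ t z - velocity p₀ p₁ t z'‖ ≤
        C * (densityModulus Ω p₀ p₁ ‖z - z'‖ + ‖z - z'‖) := by
  obtain ⟨c₀, hc₀, hle₀⟩ := h₀.bounded_away
  obtain ⟨c₁, hc₁, hle₁⟩ := h₁.bounded_away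
  obtain ⟨R, hR, hball⟩ := Metric.nhds_basis_closedBall.mem_iff.1
    (mem_interior_iff_mem_nhds.1 hx)
  obtain ⟨C, hC, hint⟩ := integral_abs_interpKernel_sub_le hΩ hconv h₀ h₁ (half_pos hR)
  set m := c₀ * c₁ * volume.real (Metric.closedBall (0 : EuclideanSpace ℝ (Fin d)) (R / 2))
  have hm : 0 < m := by
    have : 0 < volume.real (Metric.closedBall (0 : EuclideanSpace ℝ (Fin d)) (R / 2)) :=
      ENNReal.toReal_pos (Metric.measure_closedBall_pos _ _ (half_pos hR)).ne'
        (isCompact_closedBall _ _).measure_lt_top.ne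
    positivity
  have hD : 0 ≤ Metric.diam Ω := Metric.diam_nonneg
  -- With radius `R/4`, two points are within `R/2` of each other and their balls of radius `R/2`
  -- stay in the ball of radius `R` around `x`.
  refine ⟨R / 4, by positivity, 2 * Metric.diam Ω * C / m, by positivity,
    fun t ht z hz z' hz' => ?_⟩
  have hsub : ∀ y ∈ Metric.closedBall x (R / 4), Metric.closedBall y (R / 2) ⊆ Ω := fun y hy =>
    (Metric.closedBall_subset_closedBall' (by
      rw [Metric.mem_closedBall] at hy; linarith)).trans hball
  have hzz' : ‖z - z'‖ ≤ R / 2 := by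
    rw [← dist_eq_norm]
    have := dist_triangle_right z z' x
    rw [Metric.mem_closedBall] at hz hz'
    linarith
  have hk := integrable_interpKernel hΩ h₀ h₁ t
  have hks := integrable_interpKernel_smul hΩ h₀ h₁ t
  set v' := velocity p₀ p₁ t z' with hv'
  -- Centring at `v'` makes the integral of `δ - v'` against the kernel at `z'` vanish, so only the
  -- difference of kernels has to be estimated, with `‖δ - v'‖ ≤ 2 diam Ω` where either is non-zero.
  have hid : interpDensity p₀ p₁ t z • (velocity p₀ p₁ t z - v') =
      ∫ δ, (interpKernel p₀ p₁ t z δ - interpKernel p₀ p₁ t z' δ) • (δ - v') := by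
    have e : ∀ y, ∫ δ, interpKernel p₀ p₁ t y δ • (δ - v') =
        interpFlux p₀ p₁ t y - interpDensity p₀ p₁ t y • v' := fun y => by
      simp only [smul_sub]
      rw [integral_sub (hks y) ((hk y).smul_const v'), integral_smul_const]
      rfl
    have hi : ∀ y, Integrable fun δ => interpKernel p₀ p₁ t y δ • (δ - v') := fun y => by
      simp only [smul_sub]
      exact (hks y).sub ((hk y).smul_const v')
    simp only [sub_smul]
    rw [integral_sub (hi z) (hi z'), e, e, hv',
      interpDensity_smul_velocity hΩ h₀ h₁ t z', sub_self, sub_zero, smul_sub,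
      interpDensity_smul_velocity hΩ h₀ h₁ t z]
  have hnorm : interpDensity p₀ p₁ t z * ‖velocity p₀ p₁ t z - v'‖ ≤
      (2 * Metric.diam Ω) *
        ∫ δ, |interpKernel p₀ p₁ t z δ - interpKernel p₀ p₁ t z' δ| := by
    rw [← Real.norm_of_nonneg (interpDensity_nonneg h₀ h₁ t z), ← norm_smul, hid,
      ← integral_const_mul]
    refine norm_integral_le_of_norm_le (((hk z).sub (hk z')).abs.const_mul _)
      (Eventually.of_forall fun δ => ?_)
    change _ ≤ 2 * Metric.diam Ω * |interpKernel p₀ p₁ t z δ - interpKernel p₀ p₁ t z' δ|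
    rw [norm_smul, Real.norm_eq_abs, mul_comm]
    by_cases hδ : ‖δ‖ ≤ Metric.diam Ω
    · refine mul_le_mul_of_nonneg_right ?_ (abs_nonneg _)
      have := norm_velocity_le hΩ h₀ h₁ t z'
      linarith [norm_sub_le δ v']
    · have h0 : ∀ y, interpKernel p₀ p₁ t y δ = 0 := fun y => by
        by_contra h
        exact hδ (norm_le_diam_of_interpKernel_ne_zero hΩ h₀ h₁ h)
      simp [h0]
  have hge := interpDensity_ge hΩ h₀ h₁ hc₁.le hle₀ hle₁ ht (hsub z hz)
  rw [div_mul_eq_mul_div, le_div_iff₀ hm, mul_comm _ m]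
  calc m * ‖velocity p₀ p₁ t z - v'‖
      ≤ interpDensity p₀ p₁ t z * ‖velocity p₀ p₁ t z - v'‖ :=
        mul_le_mul_of_nonneg_right hge (norm_nonneg _)
    _ ≤ _ := hnorm
    _ ≤ 2 * Metric.diam Ω * (C * (densityModulus Ω p₀ p₁ ‖z - z'‖ + ‖z - z'‖)) :=
        mul_le_mul_of_nonneg_left (hint t z z' (hsub z hz) (hsub z' hz') hzz') (by positivity)
    _ = _ := by ring

/-! ### Joint law of interpolant and displacement, and the conditional expectation. -/

/-- The change of variables from interpolant and displacement to the two endpoints. -/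
theorem measurePreserving_endpoints (t : ℝ) :
    MeasurePreserving
      (fun q : EuclideanSpace ℝ (Fin d) × EuclideanSpace ℝ (Fin d) =>
        (q.1 - t • q.2, q.1 + (1 - t) • q.2)) (volume.prod volume) (volume.prod volume) := by
  -- Two shears: `(z, δ) ↦ (z - tδ, δ)`, then `(a, δ) ↦ (a, a + δ)`.
  have hskew : MeasurePreserving
      (fun q : EuclideanSpace ℝ (Fin d) × EuclideanSpace ℝ (Fin d) => (q.1, q.2 - t • q.1))
      (volume.prod volume) (volume.prod volume) :=
    (MeasurePreserving.id volume).skew_product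
      (g := fun δ z : EuclideanSpace ℝ (Fin d) => z - t • δ)
      (Continuous.measurable (by fun_prop))
      (Eventually.of_forall fun δ => (measurePreserving_sub_right volume (t • δ)).map_eq)
  have h := ((measurePreserving_prod_add volume volume).comp Measure.measurePreserving_swap).comp
    (hskew.comp Measure.measurePreserving_swap)
  convert h using 1
  ext1 q
  simp only [Function.comp_apply, Prod.fst_swap, Prod.snd_swap, Prod.swap_prod_mk]
  congr 1
  module

variable {S : Type*} [MeasurableSpace S] {P : Measure S}
  {X₀ X₁ : S → EuclideanSpace ℝ (Fin d)}

/-- The joint law of the interpolant and the displacement. -/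
theorem map_interpolant_displacement [IsProbabilityMeasure P] (hX₀ : Measurable X₀)
    (hX₁ : Measurable X₁) (hindep : IndepFun X₀ X₁ P)
    (hlaw₀ : P.map X₀ = volume.withDensity (fun x => ENNReal.ofReal (p₀ x)))
    (hlaw₁ : P.map X₁ = volume.withDensity (fun x => ENNReal.ofReal (p₁ x)))
    (hΩ : IsCompact Ω) (h₀ : IsRegularDensityOn Ω p₀) (h₁ : IsRegularDensityOn Ω p₁) (t : ℝ) :
    P.map (fun s => ((1 - t) • X₀ s + t • X₁ s, X₁ s - X₀ s)) =
      (volume.prod volume).withDensity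
        (fun q => ENNReal.ofReal (interpKernel p₀ p₁ t q.1 q.2)) := by
  have hm₀ : Measurable fun x => ENNReal.ofReal (p₀ x) := (h₀.measurable hΩ).ennreal_ofReal
  have hm₁ : Measurable fun x => ENNReal.ofReal (p₁ x) := (h₁.measurable hΩ).ennreal_ofReal
  have hpair : P.map (fun s => (X₀ s, X₁ s)) = (volume.prod volume).withDensity
      (fun q => ENNReal.ofReal (p₀ q.1) * ENNReal.ofReal (p₁ q.2)) := by
    rw [(indepFun_iff_map_prod_eq_prod_map_map hX₀.aemeasurable hX₁.aemeasurable).1 hindep,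
      hlaw₀, hlaw₁, prod_withDensity hm₀ hm₁]
  let R : EuclideanSpace ℝ (Fin d) × EuclideanSpace ℝ (Fin d) →
      EuclideanSpace ℝ (Fin d) × EuclideanSpace ℝ (Fin d) :=
    fun q => ((1 - t) • q.1 + t • q.2, q.2 - q.1)
  have hR : Measurable R := Continuous.measurable (by fun_prop)
  have hT := measurePreserving_endpoints (d := d) t
  have hcomp : P.map (fun s => ((1 - t) • X₀ s + t • X₁ s, X₁ s - X₀ s)) =
      (P.map (fun s => (X₀ s, X₁ s))).map R := by
    rw [Measure.map_map hR (hX₀.prodMk hX₁)]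
    rfl
  rw [hcomp, hpair]
  ext B hB
  rw [Measure.map_apply hR hB, withDensity_apply _ (hR hB), withDensity_apply _ hB]
  have hprod : Measurable fun q : EuclideanSpace ℝ (Fin d) × EuclideanSpace ℝ (Fin d) =>
      ENNReal.ofReal (p₀ q.1) * ENNReal.ofReal (p₁ q.2) :=
    (hm₀.comp measurable_fst).mul (hm₁.comp measurable_snd)
  -- Writing Lebesgue measure as its own image under the endpoint map, which `R` inverts, turns the
  -- integral over `R ⁻¹' B` into one over `B`.
  conv_lhs => rw [← hT.map_eq]
  rw [setLIntegral_map (hR hB) hprod hT.measurable]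
  have hinv : (fun q : EuclideanSpace ℝ (Fin d) × EuclideanSpace ℝ (Fin d) =>
      (q.1 - t • q.2, q.1 + (1 - t) • q.2)) ⁻¹' (R ⁻¹' B) = B := by
    rw [← preimage_comp]
    convert preimage_id using 2
    ext1 q
    refine Prod.ext ?_ ?_
    · change (1 - t) • (q.1 - t • q.2) + t • (q.1 + (1 - t) • q.2) = q.1
      module
    · change q.1 + (1 - t) • q.2 - (q.1 - t • q.2) = q.2
      module
  rw [hinv]
  refine lintegral_congr fun q => ?_
  simp only [interpKernel]
  rw [ENNReal.ofReal_mul (h₀.nonneg _)]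

/-- Fubini for the joint density. The choices `φ(z, δ) = v(t, z)` and `φ(z, δ) = δ` give the two
sides of the identity that characterises the conditional expectation. -/
theorem setIntegral_interpolant [IsProbabilityMeasure P] (hX₀ : Measurable X₀)
    (hX₁ : Measurable X₁) (hindep : IndepFun X₀ X₁ P)
    (hlaw₀ : P.map X₀ = volume.withDensity (fun x => ENNReal.ofReal (p₀ x)))
    (hlaw₁ : P.map X₁ = volume.withDensity (fun x => ENNReal.ofReal (p₁ x)))
    (hΩ : IsCompact Ω) (h₀ : IsRegularDensityOn Ω p₀) (h₁ : IsRegularDensityOn Ω p₁) (t : ℝ)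
    {φ : EuclideanSpace ℝ (Fin d) × EuclideanSpace ℝ (Fin d) → EuclideanSpace ℝ (Fin d)}
    (hφ : Measurable φ)
    (hint : Integrable (fun s => φ ((1 - t) • X₀ s + t • X₁ s, X₁ s - X₀ s)) P)
    {B : Set (EuclideanSpace ℝ (Fin d))} (hB : MeasurableSet B) :
    ∫ s in (fun s => (1 - t) • X₀ s + t • X₁ s) ⁻¹' B,
        φ ((1 - t) • X₀ s + t • X₁ s, X₁ s - X₀ s) ∂P =
      ∫ z in B, ∫ δ, interpKernel p₀ p₁ t z δ • φ (z, δ) := by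
  have hmap := map_interpolant_displacement hX₀ hX₁ hindep hlaw₀ hlaw₁ hΩ h₀ h₁ t
  have hm : Measurable (fun s => ((1 - t) • X₀ s + t • X₁ s, X₁ s - X₀ s)) :=
    ((hX₀.const_smul (1 - t)).add (hX₁.const_smul t)).prodMk (hX₁.sub hX₀)
  have hk : Measurable fun q : EuclideanSpace ℝ (Fin d) × EuclideanSpace ℝ (Fin d) =>
      interpKernel p₀ p₁ t q.1 q.2 :=
    (measurable_interpKernel hΩ h₀ h₁).comp
      ((measurable_const.prodMk measurable_fst).prodMk measurable_snd)
  have hBm : MeasurableSet (B ×ˢ (univ : Set (EuclideanSpace ℝ (Fin d)))) :=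
    hB.prod MeasurableSet.univ
  have hi : Integrable φ ((volume.prod volume).withDensity
      (fun q => ENNReal.ofReal (interpKernel p₀ p₁ t q.1 q.2))) := by
    rw [← hmap]
    exact (integrable_map_measure hφ.aestronglyMeasurable hm.aemeasurable).2 hint
  rw [integrable_withDensity_iff_integrable_smul' hk.ennreal_ofReal
    (Eventually.of_forall fun _ => ENNReal.ofReal_lt_top)] at hi
  have hreal : ∀ q : EuclideanSpace ℝ (Fin d) × EuclideanSpace ℝ (Fin d),
      (ENNReal.ofReal (interpKernel p₀ p₁ t q.1 q.2)).toReal = interpKernel p₀ p₁ t q.1 q.2 :=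
    fun q => ENNReal.toReal_ofReal (interpKernel_nonneg h₀ h₁ t q.1 q.2)
  simp only [hreal] at hi
  have hpre : (fun s => (1 - t) • X₀ s + t • X₁ s) ⁻¹' B =
      (fun s => ((1 - t) • X₀ s + t • X₁ s, X₁ s - X₀ s)) ⁻¹' (B ×ˢ univ) := by
    ext s; simp
  rw [hpre, ← setIntegral_map hBm hφ.aestronglyMeasurable hm.aemeasurable, hmap,
    setIntegral_withDensity_eq_setIntegral_toReal_smul hk.ennreal_ofReal
      (Eventually.of_forall fun _ => ENNReal.ofReal_lt_top) _ hBm]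
  simp only [hreal]
  rw [setIntegral_prod _ hi.integrableOn]
  simp

/-- The velocity field is a version of the conditional expectation of the displacement. -/
theorem velocity_ae_eq_condExp [IsProbabilityMeasure P] (hX₀ : Measurable X₀)
    (hX₁ : Measurable X₁) (hindep : IndepFun X₀ X₁ P)
    (hlaw₀ : P.map X₀ = volume.withDensity (fun x => ENNReal.ofReal (p₀ x)))
    (hlaw₁ : P.map X₁ = volume.withDensity (fun x => ENNReal.ofReal (p₁ x)))
    (hΩ : IsCompact Ω) (h₀ : IsRegularDensityOn Ω p₀) (h₁ : IsRegularDensityOn Ω p₁) (t : ℝ) :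
    (fun s => velocity p₀ p₁ t ((1 - t) • X₀ s + t • X₁ s)) =ᵐ[P]
      P[fun s => X₁ s - X₀ s |
        MeasurableSpace.comap (fun s => (1 - t) • X₀ s + t • X₁ s) inferInstance] := by
  have hZ : Measurable fun s => (1 - t) • X₀ s + t • X₁ s :=
    (hX₀.const_smul (1 - t)).add (hX₁.const_smul t)
  have hv : Measurable (velocity p₀ p₁ t) :=
    (measurable_velocity hΩ h₀ h₁).comp (measurable_prodMk_left (x := t))
  have hvi : Integrable (fun s => velocity p₀ p₁ t ((1 - t) • X₀ s + t • X₁ s)) P :=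
    Integrable.of_bound (hv.comp hZ).aestronglyMeasurable (Metric.diam Ω)
      (Eventually.of_forall fun s => norm_velocity_le hΩ h₀ h₁ t _)
  have hmem : ∀ {X : S → EuclideanSpace ℝ (Fin d)} {p : EuclideanSpace ℝ (Fin d) → ℝ},
      Measurable X → IsRegularDensityOn Ω p →
      P.map X = volume.withDensity (fun x => ENNReal.ofReal (p x)) → ∀ᵐ s ∂P, X s ∈ Ω := by
    intro X p hX hp hlaw
    refine ae_of_ae_map hX.aemeasurable ?_
    rw [hlaw, ae_withDensity_iff (hp.measurable hΩ).ennreal_ofReal]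
    refine Eventually.of_forall fun x hx => hp.mem_of_ne_zero fun h => hx ?_
    rw [h, ENNReal.ofReal_zero]
  have hXi : Integrable (fun s => X₁ s - X₀ s) P := by
    refine Integrable.of_bound (hX₁.sub hX₀).aestronglyMeasurable (Metric.diam Ω) ?_
    filter_upwards [hmem hX₀ h₀ hlaw₀, hmem hX₁ h₁ hlaw₁] with s hs₀ hs₁
    rw [← dist_eq_norm]
    exact Metric.dist_le_diam_of_mem hΩ.isBounded hs₁ hs₀
  refine ae_eq_condExp_of_forall_setIntegral_eq hZ.comap_le hXi
    (fun _ _ _ => hvi.integrableOn) ?_ ?_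
  · rintro _ ⟨B, hB, rfl⟩ -
    rw [setIntegral_interpolant hX₀ hX₁ hindep hlaw₀ hlaw₁ hΩ h₀ h₁ t
        (φ := fun q => velocity p₀ p₁ t q.1) (hv.comp measurable_fst) hvi hB,
      setIntegral_interpolant hX₀ hX₁ hindep hlaw₀ hlaw₁ hΩ h₀ h₁ t
        (φ := fun q => q.2) measurable_snd hXi hB]
    refine setIntegral_congr_fun hB fun z _ => ?_
    simp only
    rw [integral_smul_const]
    exact interpDensity_smul_velocity hΩ h₀ h₁ t z
  · exact (hv.comp (comap_measurable _)).aestronglyMeasurable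

/-! ### Existence and uniqueness of the flow. -/

theorem IsCaratheodorySolution.continuousOn
    {v : ℝ → EuclideanSpace ℝ (Fin d) → EuclideanSpace ℝ (Fin d)}
    {x : EuclideanSpace ℝ (Fin d)} {z : ℝ → EuclideanSpace ℝ (Fin d)}
    (hz : IsCaratheodorySolution v x z) : ContinuousOn z (Icc 0 1) := by
  have h := intervalIntegral.continuousOn_primitive_interval (a := (0 : ℝ)) (b := 1)
    (f := fun s => v s (z s)) (μ := volume) (by
      rw [uIcc_of_le zero_le_one]
      exact (intervalIntegrable_iff_integrableOn_Icc_of_le zero_le_one).1 hz.intervalIntegrable)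
  rw [uIcc_of_le zero_le_one] at h
  exact (continuousOn_const.add h).congr hz.integral_eq

theorem IsCaratheodorySolution.sub_eq_integral
    {v : ℝ → EuclideanSpace ℝ (Fin d) → EuclideanSpace ℝ (Fin d)}
    {x : EuclideanSpace ℝ (Fin d)} {z : ℝ → EuclideanSpace ℝ (Fin d)}
    (hz : IsCaratheodorySolution v x z) {s t : ℝ} (hs : s ∈ Icc (0 : ℝ) 1)
    (ht : t ∈ Icc (0 : ℝ) 1) :
    IntervalIntegrable (fun u => v u (z u)) volume s t ∧
      z t - z s = ∫ u in s..t, v u (z u) := by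
  have hi : ∀ s ∈ Icc (0 : ℝ) 1, ∀ t ∈ Icc (0 : ℝ) 1,
      IntervalIntegrable (fun u => v u (z u)) volume s t := fun s hs t ht =>
    hz.intervalIntegrable.mono_set
      (by rw [uIcc_of_le zero_le_one]; exact ordConnected_Icc.uIcc_subset hs ht)
  have h0 : (0 : ℝ) ∈ Icc (0 : ℝ) 1 := by simp
  refine ⟨hi s hs t ht, ?_⟩
  rw [hz.integral_eq t ht, hz.integral_eq s hs, add_sub_add_left_eq_sub,
    intervalIntegral.integral_interval_sub_left (hi 0 h0 t ht) (hi 0 h0 s hs)]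

theorem exists_caratheodorySolution (hΩ : IsCompact Ω) (hconv : Convex ℝ Ω)
    (h₀ : IsRegularDensityOn Ω p₀) (h₁ : IsRegularDensityOn Ω p₁)
    {x : EuclideanSpace ℝ (Fin d)} (hx : x ∈ interior Ω) :
    ∃ z : ℝ → EuclideanSpace ℝ (Fin d), IsCaratheodorySolution (velocity p₀ p₁) x z ∧
      (∀ t ∈ Ico (0 : ℝ) 1, z t ∈ interior Ω) ∧ z 1 ∈ Ω := by
  obtain ⟨z, hzc, -, hz⟩ := exists_solution_until_exit (measurable_velocity hΩ h₀ h₁)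
    (norm_velocity_le hΩ h₀ h₁) x isOpen_interior
    fun t ht => continuousOn_velocity hΩ hconv h₀ h₁ ht
  have hin : ∀ t ∈ Ico (0 : ℝ) 1, z t ∈ interior Ω := by
    intro t ht
    by_contra hbad
    have hcomp : IsCompact (Icc 0 t ∩ z ⁻¹' (interior Ω)ᶜ) :=
      isCompact_Icc.inter_right (isOpen_interior.isClosed_compl.preimage hzc)
    -- At the first exit time `τ < 1` the curve has solved the equation on all of `[0, τ]`, so
    -- `mem_interior_of_solution` contradicts the exit.
    obtain ⟨τ, ⟨hτ, hτbad⟩, hmin⟩ := hcomp.exists_isLeast ⟨t, ⟨ht.1, le_rfl⟩, hbad⟩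
    have hbefore : ∀ s ∈ Ico 0 τ, z s ∈ interior Ω := fun s hs => by
      by_contra h
      exact absurd (hmin ⟨⟨hs.1, hs.2.le.trans hτ.2⟩, h⟩) (not_le.2 hs.2)
    have hτ1 : τ < 1 := hτ.2.trans_lt ht.2
    exact hτbad (mem_interior_of_solution hΩ hconv h₀ h₁ hx hτ.1 hτ1 hzc.continuousOn
      (fun s hs => hz s ⟨hs.1, hs.2.trans hτ1.le⟩
        fun u hu => hbefore u ⟨hu.1, hu.2.trans_le hs.2⟩) hbefore)
  refine ⟨z, ⟨?_, fun t ht => hz t ht fun s hs => hin s ⟨hs.1, hs.2.trans_le ht.2⟩⟩, hin, ?_⟩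
  · exact intervalIntegrable_of_measurable_of_bounded
      ((measurable_velocity hΩ h₀ h₁).comp (measurable_id.prodMk hzc.measurable))
      (fun s => norm_velocity_le hΩ h₀ h₁ s (z s)) 0 1
  · refine hΩ.isClosed.mem_of_tendsto
      ((hzc.tendsto 1).mono_left (nhdsWithin_le_nhds (s := Iio 1))) ?_
    filter_upwards [Ico_mem_nhdsLT (zero_lt_one' ℝ)] with t ht
    exact interior_subset (hin t ht)

/-- Two solutions agree as long as one of them stays in `interior Ω`. -/
theorem IsCaratheodorySolution.eqOn (hΩ : IsCompact Ω) (hconv : Convex ℝ Ω)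
    (h₀ : IsRegularDensityOn Ω p₀) (h₁ : IsRegularDensityOn Ω p₁)
    (hosgood : IsOsgood (fun η => densityModulus Ω p₀ p₁ η + η))
    {x : EuclideanSpace ℝ (Fin d)} {y z : ℝ → EuclideanSpace ℝ (Fin d)}
    (hy : IsCaratheodorySolution (velocity p₀ p₁) x y)
    (hz : IsCaratheodorySolution (velocity p₀ p₁) x z)
    (hin : ∀ t ∈ Ico (0 : ℝ) 1, z t ∈ interior Ω) : EqOn y z (Icc 0 1) := by
  have hyc := hy.continuousOn
  have hzc := hz.continuousOn
  -- Continuous induction: the coincidence set is closed, contains `0`, and has points just to the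
  -- right of each of its points `τ < 1`. Closedness alone reaches time `1`, where `z` may touch the
  -- boundary.
  refine IsClosed.Icc_subset_of_forall_exists_gt (s := {t | y t = z t}) ?_ ?_ ?_
  · have h := (hyc.sub hzc).preimage_isClosed_of_isClosed isClosed_Icc
      (isClosed_singleton (x := (0 : EuclideanSpace ℝ (Fin d))))
    convert h using 1
    ext t
    simp [sub_eq_zero, and_comm]
  · have h0 : (0 : ℝ) ∈ Icc (0 : ℝ) 1 := by simp
    simp [hy.integral_eq 0 h0, hz.integral_eq 0 h0]
  · rintro τ ⟨hτeq, hτ⟩ u hu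
    have hτeq' : y τ = z τ := hτeq
    have hτI : τ ∈ Icc (0 : ℝ) 1 := Ico_subset_Icc_self hτ
    obtain ⟨ρ, hρ, C, hC, hmod⟩ := exists_velocity_modulus hΩ hconv h₀ h₁ (hin τ hτ)
    obtain ⟨ε₁, hε₁, hball₁⟩ := Metric.continuousWithinAt_iff.1 (hyc τ hτI) ρ hρ
    obtain ⟨ε₂, hε₂, hball₂⟩ := Metric.continuousWithinAt_iff.1 (hzc τ hτI) ρ hρ
    -- Up to `b` both curves stay in the ball around `y τ = z τ` where the modulus applies; for `y`
    -- this follows from continuity alone.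
    obtain ⟨b, hτb, hb⟩ : ∃ b, τ < b ∧ b < min (min (τ + ε₁) (τ + ε₂)) (min 1 u) :=
      exists_between (lt_min (lt_min (by linarith) (by linarith)) (lt_min hτ.2 hu))
    simp only [lt_min_iff] at hb
    obtain ⟨⟨hb₁, hb₂⟩, hb1, hbu⟩ := hb
    have hI : ∀ t ∈ Icc τ b, t ∈ Icc (0 : ℝ) 1 := fun t ht =>
      ⟨hτ.1.trans ht.1, ht.2.trans hb1.le⟩
    have hdist : ∀ t ∈ Icc τ b, dist t τ = t - τ := fun t ht => by
      rw [Real.dist_eq, abs_of_nonneg (sub_nonneg.2 ht.1)]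
    have hyb : ∀ t ∈ Icc τ b, y t ∈ Metric.closedBall (z τ) ρ := fun t ht => by
      rw [← hτeq']
      exact (hball₁ (hI t ht) (by rw [hdist t ht]; linarith [ht.2])).le
    have hzb : ∀ t ∈ Icc τ b, z t ∈ Metric.closedBall (z τ) ρ := fun t ht =>
      (hball₂ (hI t ht) (by rw [hdist t ht]; linarith [ht.2])).le
    have hwc : ContinuousOn (fun t => ‖y t - z t‖) (Icc τ b) :=
      ((hyc.mono hI).sub (hzc.mono hI)).norm
    have hle : ∀ t ∈ Icc τ b, ‖y t - z t‖ ≤ ∫ s in τ..t,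
        C * (densityModulus Ω p₀ p₁ ‖y s - z s‖ + ‖y s - z s‖) := by
      intro t ht
      obtain ⟨hyi, hye⟩ := hy.sub_eq_integral hτI (hI t ht)
      obtain ⟨hzi, hze⟩ := hz.sub_eq_integral hτI (hI t ht)
      have e : y t - z t = ∫ s in τ..t, (velocity p₀ p₁ s (y s) - velocity p₀ p₁ s (z s)) := by
        rw [intervalIntegral.integral_sub hyi hzi, ← hye, ← hze, hτeq', sub_sub_sub_cancel_right]
      have hsub : Icc τ t ⊆ Icc τ b := Icc_subset_Icc_right ht.2
      rw [e]
      refine intervalIntegral.norm_integral_le_of_norm_le ht.1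
        (Eventually.of_forall fun s hs => ?_) ?_
      · have hs' : s ∈ Icc τ b := hsub (Ioc_subset_Icc_self hs)
        exact hmod s (hI s hs') _ (hyb s hs') _ (hzb s hs')
      · exact (intervalIntegrable_comp_of_monotoneOn hosgood.monotoneOn ht.1 (hwc.mono hsub)
          fun _ _ => norm_nonneg _).const_mul C
    have hzero := hosgood.eq_zero_of_le_integral
      (fun u hu => add_pos_of_nonneg_of_pos (densityModulus_nonneg u) hu) hC hwc
      (fun _ _ => norm_nonneg _) hle b ⟨hτb.le, le_rfl⟩
    exact ⟨b, sub_eq_zero.1 (norm_eq_zero.1 hzero), hτb, hbu.le⟩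

end RectifiedFlow

theorem mainTheorem2 {d : ℕ} {S : Type*} [MeasurableSpace S]
    (P : Measure S) [IsProbabilityMeasure P]
    (X₀ X₁ : S → EuclideanSpace ℝ (Fin d)) (hX₀ : Measurable X₀) (hX₁ : Measurable X₁)
    (hindep : IndepFun X₀ X₁ P)
    (p₀ p₁ : EuclideanSpace ℝ (Fin d) → ℝ)
    (hlaw₀ : P.map X₀ = volume.withDensity (fun x => ENNReal.ofReal (p₀ x)))
    (hlaw₁ : P.map X₁ = volume.withDensity (fun x => ENNReal.ofReal (p₁ x)))
    (Ω : Set (EuclideanSpace ℝ (Fin d)))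
    (hcompact : IsCompact Ω) (hconvex : Convex ℝ Ω) (hint : (interior Ω).Nonempty)
    (hp₀ : RectifiedFlow.IsRegularDensityOn Ω p₀)
    (hp₁ : RectifiedFlow.IsRegularDensityOn Ω p₁)
    (hosgood : RectifiedFlow.IsOsgood
      (fun η => RectifiedFlow.densityModulus Ω p₀ p₁ η + η)) :
    -- the velocity field is the version of the conditional expectation continuous on `interior Ω`
    (∀ t ∈ Icc (0 : ℝ) 1,
      ContinuousOn (RectifiedFlow.velocity p₀ p₁ t) (interior Ω) ∧
      (fun s => RectifiedFlow.velocity p₀ p₁ t ((1 - t) • X₀ s + t • X₁ s)) =ᵐ[P]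
        P[fun s => X₁ s - X₀ s |
          MeasurableSpace.comap (fun s => (1 - t) • X₀ s + t • X₁ s) inferInstance]) ∧
    -- existence and uniqueness of the solution, which stays in the interior before time `1`
    ∀ x ∈ interior Ω, ∃ z : ℝ → EuclideanSpace ℝ (Fin d),
      RectifiedFlow.IsCaratheodorySolution (RectifiedFlow.velocity p₀ p₁) x z ∧
      (∀ t ∈ Ico (0 : ℝ) 1, z t ∈ interior Ω) ∧ z 1 ∈ Ω ∧
      ∀ y : ℝ → EuclideanSpace ℝ (Fin d),
        RectifiedFlow.IsCaratheodorySolution (RectifiedFlow.velocity p₀ p₁) x y →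
        EqOn y z (Icc 0 1) := by
  refine ⟨fun t ht => ⟨?_, ?_⟩, fun x hx => ?_⟩
  · exact RectifiedFlow.continuousOn_velocity hcompact hconvex hp₀ hp₁ ht
  · exact RectifiedFlow.velocity_ae_eq_condExp hX₀ hX₁ hindep hlaw₀ hlaw₁ hcompact hp₀ hp₁ t
  · obtain ⟨z, hz, hin, hz1⟩ :=
      RectifiedFlow.exists_caratheodorySolution hcompact hconvex hp₀ hp₁ hx
    exact ⟨z, hz, hin, hz1, fun y hy =>
      RectifiedFlow.IsCaratheodorySolution.eqOn hcompact hconvex hp₀ hp₁ hosgood hy hz hin⟩
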